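/- Let $K$ be a field and let $k\ge 1$ be an integer. All algebras are finite-dimensional $K$-algebras and all modules are finite-dimensional left modules; $D=\operatorname{Hom}_K(-,K)$. For a module $M$, $\operatorname{add}M$ is the class of direct summands of finite direct sums of copies of $M$; $\operatorname{cogen}^{j}(M)$ is the class of modules $X$ admitting an exact sequence $0\to X\to M_0\to\cdots\to M_j$ with all $M_i\in\operatorname{add}M$ on which $\operatorname{Hom}(-,M)$ is exact (that is, $\operatorname{Hom}(M_j,M)\to\cdots\to\operatorname{Hom}(M_0,M)\to\operatorname{Hom}(X,M)\to0$ is exact); and ${}^{\perp}C$ is the class of modules $X$ with $\operatorname{Ext}^i(X,C)=0$ for all $i\ge1$. A module $C$ is self-orthogonal if $C\in{}^{\perp}C$. A $\Lambda$-module $C$ is $k$-cotilting if it is self-orthogonal, has injective dimension at most $k$, and there is an exact sequence $0\to C_k\to\cdots\to C_0\to D\Lambda\to0$ with all $C_i\in\operatorname{add}C$. A $\Gamma$-module $N$ is faithfully balanced if the natural map $\Gamma\to\operatorname{End}_{\operatorname{End}_\Gamma(N)}(N)$ is bijective. For an injective $\Gamma$-module $J$, $N$ is $J$-restricted $k$-cotilting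 if $N$ is self-orthogonal and there are exact sequences $0\to N\to J_0\to\cdots\to J_k\to0$ with all $J_i\in\operatorname{add}J$ and $0\to N_k\to\cdots\to N_0\to J\to0$ with all $N_i\in\operatorname{add}N$. Two triples $(\Lambda,M,G)$ and $(\Lambda',M',G')$, each consisting of an algebra and two modules over it, are equivalent if there is a $K$-linear Morita equivalence from $\Lambda$ to $\Lambda'$ restricting to equivalences $\operatorname{add}M\to\operatorname{add}M'$ and $\operatorname{add}G\to\operatorname{add}G'$; $[\Lambda,M,G]$ denotes the equivalence class. The endomorphism ring $\operatorname{End}_\Lambda(M)$ acts on $M$ from the left. Consider the assignments $$AS:[\Lambda,M,G]\mapsto[\operatorname{End}_\Lambda(M),\,M,\,\operatorname{Hom}_\Lambda(G,M)],\qquad \text{dual }AS:[\Lambda,M,H]\mapsto[\operatorname{End}_\Lambda(M),\,M,\,D\operatorname{Hom}_\Lambda(M,H)],$$ $$s:[\Lambda,M,G]\mapsto[\Lambda,G,M],\qquad (-)^{\mathrm{op}}:[\Lambda,M,G]\mapsto[\Lambda^{\mathrm{op}},DM,DG].$$ Theorem. Consider the following three sets of equivalence classes: (1) the classes $[\Lambda,M,C]$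 such that $C$ is a $k$-cotilting module, $C\in\operatorname{add}M$ and $\operatorname{cogen}^{k-1}(M)=\operatorname{cogen}^{k-1}(C)={}^{\perp}C$; (2) the classes $[\Gamma,N,J]$ such that $J\in\operatorname{add}D\Gamma$ and $N$ is faithfully balanced and $J$-restricted $k$-cotilting; (3) the classes $[B,G,Q]$ such that $Q$ is a $k$-cotilting module, $B\in\operatorname{add}G$ and $G\in\operatorname{cogen}^{k-1}(Q)$. Then the dual $AS$ assignment gives a well-defined bijection $(1)\to(2)$, the assignment $s\circ AS\circ s$ gives a well-defined bijection $(1)\to(3)$, the assignment $(-)^{\mathrm{op}}\circ AS\circ s$ gives a well-defined bijection $(2)\to(3)$, and the triangle commutes: $\big((-)^{\mathrm{op}}\circ AS\circ s\big)\circ(\text{dual }AS)=s\circ AS\circ s$ on the set (1). -/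

import Mathlib

universe u

open CategoryTheory CategoryTheory.Abelian

/-- A finite-dimensional left module over a `K`-algebra `A`; the `K`-vector space structure is the
one induced by `A`. These are the objects of `A`-mod. -/
structure FDModule (K : Type u) [Field K] (A : Type u) [Ring A] [Algebra K A] where
  carrier : Type u
  [addCommGroup : AddCommGroup carrier]
  [moduleK : Module K carrier]
  [moduleA : Module A carrier]
  [isScalarTower : IsScalarTower K A carrier]
  [finite : Module.Finite K carrier]

namespace FDModule

attribute [instance] addCommGroup moduleK moduleA isScalarTower finite

instance (K : Type u) [Field K] (A : Type u) [Ring A] [Algebra K A] :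
    CoeSort (FDModule K A) (Type u) := ⟨carrier⟩

/-- The underlying object of Mathlib's category of `A`-modules. -/
abbrev toModuleCat {K : Type u} [Field K] {A : Type u} [Ring A] [Algebra K A]
    (X : FDModule K A) : ModuleCat.{u} A := ModuleCat.of A X

end FDModule

/-- `X ∈ add M`: the module `X` is a direct summand of a finite direct sum of copies of `M`. -/
def InAdd (A : Type u) [Ring A] (M X : Type u) [AddCommGroup M] [Module A M]
    [AddCommGroup X] [Module A X] : Prop :=
  ∃ (n : ℕ) (i : X →ₗ[A] (Fin n → M)) (p : (Fin n → M) →ₗ[A] X), p ∘ₗ i = LinearMap.id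

section Modules

variable {K : Type u} [Field K] {A : Type u} [Ring A] [Algebra K A]

/-- The sequence `0 → Z 0 → Z 1 → ⋯ → Z (n + 1)` is exact
(nothing is required at the last term, and the terms `Z i` with `i > n + 1` play no role). -/
def IsLeftExactSeq (n : ℕ) (Z : ℕ → FDModule K A) (d : ∀ i, Z i →ₗ[A] Z (i + 1)) : Prop :=
  Function.Injective (d 0) ∧ ∀ i < n, Function.Exact (d i) (d (i + 1))

/-- The sequence `0 → Z 0 → Z 1 → ⋯ → Z (n + 1) → 0` is exact. -/
def IsExactSeq (n : ℕ) (Z : ℕ → FDModule K A) (d : ∀ i, Z i →ₗ[A] Z (i + 1)) : Prop :=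
  IsLeftExactSeq n Z d ∧ Function.Surjective (d n)

/-- The sequence `Hom(Z (n + 1), M) → ⋯ → Hom(Z 1, M) → Hom(Z 0, M) → 0` is exact. -/
def HomIntoExact (n : ℕ) (Z : ℕ → FDModule K A) (d : ∀ i, Z i →ₗ[A] Z (i + 1))
    (M : FDModule K A) : Prop :=
  Function.Surjective (fun f : Z 1 →ₗ[A] M => f ∘ₗ d 0) ∧
    ∀ i < n, Function.Exact (fun f : Z (i + 2) →ₗ[A] M => f ∘ₗ d (i + 1))
      (fun f : Z (i + 1) →ₗ[A] M => f ∘ₗ d i)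

/-- `cogen^k(M)`: the modules `N` with an exact sequence `0 → N → M_0 → ⋯ → M_k`, all `M_i` in
`add M`, on which `Hom(-, M)` is exact. Here `Z 0 = N` and `Z (i + 1) = M_i`. -/
def cogen (k : ℕ) (M : FDModule K A) : Set (FDModule K A) :=
  {N | ∃ (Z : ℕ → FDModule K A) (d : ∀ i, Z i →ₗ[A] Z (i + 1)),
    Nonempty (Z 0 ≃ₗ[A] N) ∧ (∀ i ≤ k, InAdd A M (Z (i + 1))) ∧
      IsLeftExactSeq k Z d ∧ HomIntoExact k Z d M}

/-- The left perpendicular category: the modules `X` with `Ext^i(X, C) = 0` for all `i ≥ 1`. -/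
def leftPerp (C : FDModule K A) : Set (FDModule K A) :=
  {X | ∀ i : ℕ, 1 ≤ i → Subsingleton (Ext X.toModuleCat C.toModuleCat i)}

/-- `Ext^i(C, C) = 0` for all `i ≥ 1`. -/
def IsSelfOrthogonal (C : FDModule K A) : Prop :=
  ∀ i : ℕ, 1 ≤ i → Subsingleton (Ext C.toModuleCat C.toModuleCat i)

/-- The natural map from `A` to the endomorphism ring of `M` as an `End_A(M)`-module is
bijective. -/
def IsFaithfullyBalanced (M : FDModule K A) : Prop :=
  Function.Bijective (Module.toModuleEnd (Module.End A M) (S := A) M)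

end Modules

/-! ### Dual modules -/

section Duals

variable (K : Type u) [Field K] (A : Type u) [Ring A] [Algebra K A]

/-- The space `D A = Hom_K(A, K)`. -/
def DualRegular : Type u := A →ₗ[K] K

noncomputable instance : AddCommGroup (DualRegular K A) :=
  inferInstanceAs (AddCommGroup (A →ₗ[K] K))

noncomputable instance : Module K (DualRegular K A) :=
  inferInstanceAs (Module K (A →ₗ[K] K))

/-- The left `A`-module structure on `D A`: `(a • φ) x = φ (x * a)`. -/
noncomputable instance : Module A (DualRegular K A) where
  smul a φ := LinearMap.comp (show A →ₗ[K] K from φ) (LinearMap.mulRight K a)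
  one_smul φ := by
    refine LinearMap.ext fun x => ?_
    exact congrArg (show A →ₗ[K] K from φ) (mul_one x)
  mul_smul a b φ := by
    refine LinearMap.ext fun x => ?_
    exact congrArg (show A →ₗ[K] K from φ) (mul_assoc x a b).symm
  smul_zero a := rfl
  smul_add a φ ψ := rfl
  add_smul a b φ := by
    refine LinearMap.ext fun x => ?_
    exact (congrArg (show A →ₗ[K] K from φ) (mul_add x a b)).trans (LinearMap.map_add _ _ _)
  zero_smul φ := by
    refine LinearMap.ext fun x => ?_
    exact (congrArg (show A →ₗ[K] K from φ) (mul_zero x)).trans (LinearMap.map_zero _)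

instance : IsScalarTower K A (DualRegular K A) where
  smul_assoc c a φ := by
    refine LinearMap.ext fun x => ?_
    exact (congrArg (show A →ₗ[K] K from φ) (mul_smul_comm c x a)).trans
      (LinearMap.map_smul _ _ _)

variable [Module.Finite K A]

instance : Module.Finite K (DualRegular K A) :=
  inferInstanceAs (Module.Finite K (A →ₗ[K] K))

/-- The regular left module `A`. -/
abbrev FDModule.regular : FDModule K A := ⟨A⟩

/-- The injective cogenerator `D A` as a left `A`-module. -/
noncomputable abbrev FDModule.dualRegular : FDModule K A := ⟨DualRegular K A⟩

end Duals

section OppositeDual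

variable (K : Type u) [Field K] {A : Type u} [Ring A] [Algebra K A] (X : FDModule K A)

/-- The space `D X = Hom_K(X, K)`. -/
def OpDual : Type u := X →ₗ[K] K

noncomputable instance : AddCommGroup (OpDual K X) :=
  inferInstanceAs (AddCommGroup (X →ₗ[K] K))

noncomputable instance : Module K (OpDual K X) :=
  inferInstanceAs (Module K (X →ₗ[K] K))

instance : Module.Finite K (OpDual K X) :=
  inferInstanceAs (Module.Finite K (X →ₗ[K] K))

/-- For a left `A`-module `X`, the left `Aᵐᵒᵖ`-module structure on `D X`:
`(op a • φ) x = φ (a • x)`. -/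
noncomputable instance : Module Aᵐᵒᵖ (OpDual K X) where
  smul a φ := LinearMap.comp (show X →ₗ[K] K from φ) (Algebra.lsmul K K X a.unop)
  one_smul φ := by
    refine LinearMap.ext fun x => ?_
    exact congrArg (show X →ₗ[K] K from φ) (one_smul A x)
  mul_smul a b φ := by
    refine LinearMap.ext fun x => ?_
    exact congrArg (show X →ₗ[K] K from φ) (mul_smul b.unop a.unop x)
  smul_zero a := rfl
  smul_add a φ ψ := rfl
  add_smul a b φ := by
    refine LinearMap.ext fun x => ?_
    exact (congrArg (show X →ₗ[K] K from φ) (add_smul a.unop b.unop x)).trans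
      (LinearMap.map_add _ _ _)
  zero_smul φ := by
    refine LinearMap.ext fun x => ?_
    exact (congrArg (show X →ₗ[K] K from φ) (zero_smul A x)).trans (LinearMap.map_zero _)

instance : IsScalarTower K Aᵐᵒᵖ (OpDual K X) where
  smul_assoc c a φ := by
    refine LinearMap.ext fun x => ?_
    exact (congrArg (show X →ₗ[K] K from φ) (smul_assoc c a.unop x)).trans
      (LinearMap.map_smul _ _ _)

end OppositeDual

section Hom

variable {K : Type u} [Field K] {A : Type u} [Ring A] [Algebra K A]

instance instFiniteHom (X Y : FDModule K A) : Module.Finite K (X →ₗ[A] Y) :=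
  Module.Finite.of_injective (LinearMap.restrictScalarsₗ K A X Y K)
    (LinearMap.restrictScalars_injective K)

instance instFiniteEnd (X : FDModule K A) : Module.Finite K (Module.End A X) :=
  instFiniteHom X X

variable (K) in
/-- The space `D Hom_A(M, H)`. -/
def DualHom (M H : FDModule K A) : Type u := (M →ₗ[A] H) →ₗ[K] K

variable (M H : FDModule K A)

noncomputable instance : AddCommGroup (DualHom K M H) :=
  inferInstanceAs (AddCommGroup ((M →ₗ[A] H) →ₗ[K] K))

noncomputable instance : Module K (DualHom K M H) :=
  inferInstanceAs (Module K ((M →ₗ[A] H) →ₗ[K] K))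

instance : Module.Finite K (DualHom K M H) :=
  inferInstanceAs (Module.Finite K ((M →ₗ[A] H) →ₗ[K] K))

/-- Precomposition with an endomorphism of `M`, as a `K`-linear map. -/
def precompEnd (γ : Module.End A M) : (M →ₗ[A] H) →ₗ[K] (M →ₗ[A] H) where
  toFun f := f ∘ₗ γ
  map_add' _ _ := rfl
  map_smul' _ _ := rfl

/-- The left `End_A(M)`-module structure on `D Hom_A(M, H)`: `(γ • φ) f = φ (f ∘ γ)`. -/
noncomputable instance : Module (Module.End A M) (DualHom K M H) where
  smul γ φ := LinearMap.comp (show (M →ₗ[A] H) →ₗ[K] K from φ) (precompEnd M H γ)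
  one_smul φ := rfl
  mul_smul a b φ := rfl
  smul_zero a := rfl
  smul_add a φ ψ := rfl
  add_smul a b φ := by
    refine LinearMap.ext fun f => ?_
    exact (congrArg (show (M →ₗ[A] H) →ₗ[K] K from φ) (LinearMap.comp_add a b f)).trans
      (LinearMap.map_add _ _ _)
  zero_smul φ := by
    refine LinearMap.ext fun f => ?_
    exact (congrArg (show (M →ₗ[A] H) →ₗ[K] K from φ) (LinearMap.comp_zero f)).trans
      (LinearMap.map_zero _)

instance : IsScalarTower K (Module.End A M) (DualHom K M H) where
  smul_assoc c a φ := by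
    refine LinearMap.ext fun f => ?_
    have h : f ∘ₗ (c • a) = c • (f ∘ₗ a) := by
      refine LinearMap.ext fun x => ?_
      exact LinearMap.map_smul_of_tower f c (a x)
    exact (congrArg (show (M →ₗ[A] H) →ₗ[K] K from φ) h).trans (LinearMap.map_smul _ _ _)

end Hom

/-! ### Cotilting modules and restricted cotilting modules -/

section Cotilting

variable {K : Type u} [Field K] {A : Type u} [Ring A] [Algebra K A] [Module.Finite K A]

/-- `C` is a `k`-cotilting module: it is self-orthogonal of injective dimension at most `k`, and
there is an exact sequence `0 → C_k → ⋯ → C_0 → D A → 0` with all `C_i` in `add C`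
(here `Z (k + 1) = D A` and `Z i = C_{k - i}` for `i ≤ k`). -/
def IsCotilting (k : ℕ) (C : FDModule K A) : Prop :=
  IsSelfOrthogonal C ∧ HasInjectiveDimensionLE C.toModuleCat k ∧
    ∃ (Z : ℕ → FDModule K A) (d : ∀ i, Z i →ₗ[A] Z (i + 1)),
      IsExactSeq k Z d ∧ (∀ i ≤ k, InAdd A C (Z i)) ∧
        Nonempty (Z (k + 1) ≃ₗ[A] FDModule.dualRegular K A)

/-- `N` is `J`-restricted `k`-cotilting, for an injective module `J`: there is an exact sequence
`0 → N → J_0 → ⋯ → J_k → 0` with all `J_i` in `add J`, the module `N` is self-orthogonal, and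
there is an exact sequence `0 → N_k → ⋯ → N_0 → J → 0` with all `N_i` in `add N`. -/
def IsRestrictedCotilting (k : ℕ) (J N : FDModule K A) : Prop :=
  Module.Injective A J ∧
    (∃ (Z : ℕ → FDModule K A) (d : ∀ i, Z i →ₗ[A] Z (i + 1)),
      IsExactSeq k Z d ∧ Nonempty (Z 0 ≃ₗ[A] N) ∧ ∀ i ≤ k, InAdd A J (Z (i + 1))) ∧
    IsSelfOrthogonal N ∧
    ∃ (Z : ℕ → FDModule K A) (d : ∀ i, Z i →ₗ[A] Z (i + 1)),
      IsExactSeq k Z d ∧ (∀ i ≤ k, InAdd A N (Z i)) ∧ Nonempty (Z (k + 1) ≃ₗ[A] J)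

end Cotilting

/-! ### Triples and assignments -/

/-- A triple `(A, M, G)`: a finite-dimensional `K`-algebra with two finite-dimensional left
modules. -/
structure AlgTriple (K : Type u) [Field K] where
  alg : Type u
  [ring : Ring alg]
  [algebra : Algebra K alg]
  [finite : Module.Finite K alg]
  fst : FDModule K alg
  snd : FDModule K alg

namespace AlgTriple

variable {K : Type u} [Field K]

attribute [instance] ring algebra finite

/-- Two triples are equivalent if there is a (`K`-linear) Morita equivalence of the algebras that
restricts to equivalences between the `add`-categories of the first, respectively second,
modules. -/
def Equivalent (s t : AlgTriple K) : Prop :=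
  ∃ e : MoritaEquivalence K s.alg t.alg,
    (∀ X : ModuleCat.{u} s.alg,
      InAdd s.alg s.fst X ↔ InAdd t.alg t.fst (e.eqv.functor.obj X)) ∧
    (∀ X : ModuleCat.{u} s.alg,
      InAdd s.alg s.snd X ↔ InAdd t.alg t.snd (e.eqv.functor.obj X))

end AlgTriple

/-- Membership in `add M` is invariant under isomorphism. -/
theorem InAdd.of_equiv {A : Type u} [Ring A] {M X Y : Type u} [AddCommGroup M] [Module A M]
    [AddCommGroup X] [Module A X] [AddCommGroup Y] [Module A Y] (e : X ≃ₗ[A] Y)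
    (h : InAdd A M X) : InAdd A M Y := by
  obtain ⟨n, i, p, hip⟩ := h
  refine ⟨n, i ∘ₗ e.symm.toLinearMap, e.toLinearMap ∘ₗ p, ?_⟩
  refine LinearMap.ext fun y => ?_
  have := LinearMap.congr_fun hip (e.symm y)
  simp only [LinearMap.comp_apply, LinearMap.id_apply] at this
  simp [this]

namespace AlgTriple

variable {K : Type u} [Field K]

theorem Equivalent.refl (t : AlgTriple K) : Equivalent t t :=
  ⟨MoritaEquivalence.refl K t.alg, fun _ => Iff.rfl, fun _ => Iff.rfl⟩

theorem Equivalent.symm {s t : AlgTriple K} (h : Equivalent s t) : Equivalent t s := by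
  obtain ⟨e, h₁, h₂⟩ := h
  refine ⟨e.symm, fun X => ?_, fun X => ?_⟩
  · refine Iff.trans ?_ (h₁ _).symm
    exact ⟨InAdd.of_equiv (e.eqv.counitIso.app X).toLinearEquiv.symm,
      InAdd.of_equiv (e.eqv.counitIso.app X).toLinearEquiv⟩
  · refine Iff.trans ?_ (h₂ _).symm
    exact ⟨InAdd.of_equiv (e.eqv.counitIso.app X).toLinearEquiv.symm,
      InAdd.of_equiv (e.eqv.counitIso.app X).toLinearEquiv⟩

theorem Equivalent.trans {r s t : AlgTriple K} (h : Equivalent r s) (h' : Equivalent s t) :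
    Equivalent r t := by
  obtain ⟨e, h₁, h₂⟩ := h
  obtain ⟨e', h₁', h₂'⟩ := h'
  exact ⟨e.trans K e', fun X => (h₁ X).trans (h₁' _), fun X => (h₂ X).trans (h₂' _)⟩

variable (K) in
/-- Equivalence of triples as a setoid. -/
instance setoid : Setoid (AlgTriple K) :=
  ⟨Equivalent, Equivalent.refl, Equivalent.symm, Equivalent.trans⟩

/-- The Auslander-Solberg assignment `(A, M, G) ↦ (End_A(M), M, Hom_A(G, M))`. -/
def AS (t : AlgTriple K) : AlgTriple K where
  alg := Module.End t.alg t.fst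
  fst := ⟨t.fst⟩
  snd := ⟨t.snd →ₗ[t.alg] t.fst⟩

/-- The dual Auslander-Solberg assignment `(A, M, H) ↦ (End_A(M), M, D Hom_A(M, H))`. -/
noncomputable def dualAS (t : AlgTriple K) : AlgTriple K where
  alg := Module.End t.alg t.fst
  fst := ⟨t.fst⟩
  snd := ⟨DualHom K t.fst t.snd⟩

/-- The swap `(A, M, G) ↦ (A, G, M)`. -/
def swap (t : AlgTriple K) : AlgTriple K where
  alg := t.alg
  fst := t.snd
  snd := t.fst

/-- Passing to the opposite algebra, `(A, M, G) ↦ (Aᵒᵖ, D M, D G)`. -/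
noncomputable def op (t : AlgTriple K) : AlgTriple K where
  alg := t.algᵐᵒᵖ
  fst := ⟨OpDual K t.fst⟩
  snd := ⟨OpDual K t.snd⟩

/-- `(Λ, M, C)` with `C` a `k`-cotilting module in `add M` and
`cogen^{k-1}(M) = cogen^{k-1}(C) = ⊥C`. -/
def IsCogenTriple (k : ℕ) (t : AlgTriple K) : Prop :=
  IsCotilting k t.snd ∧ InAdd t.alg t.fst t.snd ∧
    cogen (k - 1) t.fst = cogen (k - 1) t.snd ∧ cogen (k - 1) t.snd = leftPerp t.snd

/-- `(Γ, N, J)` with `J ∈ add (D Γ)` and `N` faithfully balanced and `J`-restricted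
`k`-cotilting. -/
def IsRestrictedTriple (k : ℕ) (t : AlgTriple K) : Prop :=
  InAdd t.alg (FDModule.dualRegular K t.alg) t.snd ∧
    IsFaithfullyBalanced t.fst ∧ IsRestrictedCotilting k t.snd t.fst

/-- `(B, G, Q)` with `Q` a `k`-cotilting module, `B ∈ add G` and `G ∈ cogen^{k-1}(Q)`. -/
def IsGeneratorTriple (k : ℕ) (t : AlgTriple K) : Prop :=
  IsCotilting k t.snd ∧ InAdd t.alg t.fst t.alg ∧ t.fst ∈ cogen (k - 1) t.snd

end AlgTriple

/-- The equivalence classes `[A, M, G]` of triples. -/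
abbrev TripleClass (K : Type u) [Field K] : Type (u + 1) := Quotient (AlgTriple.setoid K)

/-- The set of classes `[A, M, G]` of the triples `(A, M, G)` with a given property. -/
def classesOf {K : Type u} [Field K] (P : AlgTriple K → Prop) : Set (TripleClass K) :=
  {c | ∃ t : AlgTriple K, P t ∧ ⟦t⟧ = c}

/-! The proof rests on the contravariant functor `D Hom(M, -)` from `A`-modules to `End(M)`-modules.
It sends `M` to `D End(M)` and `D A` to `M`, and it reverses any exact sequence whose terms and
cosyzygies have no higher extensions from `M` (`HasChain.dualHom`).

Both cotilting notions are instances of one relation, `IsLinked`. A module `C` is cotilting when it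
is self-orthogonal and linked to `D A`; `N` is `J`-restricted cotilting when `J` is injective and
`N` is self-orthogonal and linked to `J`. Reversal turns the link `(C, D A)` into `(M, D Hom(M,
C))`, and the link `(N, J)` into `(D Hom(N, J), D End(N))`. Hence dual `AS` exchanges (1) and (2).

Orthogonality over the new algebra and reflexivity both come from `IsGood M W X`. It holds for `X`
in `add M`, because `D Hom(M, M)` is injective, and it spreads along exact sequences by a five-lemma
argument (`IsGood.step`), reaching `D A` in (1) and `J` in (2). Taking `W = A` yields bicommutants
and self-orthogonality. Taking `C` in place of `M`, and `M` as `W`, yields `M ≅ Hom(Hom(M, C), C)`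
and `Ext(Hom(M, C), C) = 0` over `End(C)`, which is what (1) ↔ (3) needs.

The conditions on `cogen` are equivalent to vanishing of extensions: if `C` is cotilting, `C ∈ add
M` and `Ext(M, C) = 0`, then `cogen^{k-1}(M) = ⊥C` (`IsCotilting.cogen_eq_leftPerp`).

On the classes concerned, dual `AS` and `s ∘ AS ∘ s` are inverse to themselves. The map (2) → (3) is
the composite through (1), and `triangle` computes it. That the assignments descend to classes
follows from `MoritaEquivalence.exists_addCorr_end`. -/

/-! ### The additive closure of a module -/

section InAdd

variable {A : Type u} [Ring A] {L M N X Y : Type u}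
  [AddCommGroup L] [Module A L] [AddCommGroup M] [Module A M] [AddCommGroup N] [Module A N]
  [AddCommGroup X] [Module A X] [AddCommGroup Y] [Module A Y]

/-- Writing the identity of `X` as a finite sum of maps through `M` is the working form of `InAdd`:
additive functors preserve such an identity, so all the Hom functors below respect `add`. -/
theorem InAdd.exists_sum_comp (h : InAdd A M X) :
    ∃ (n : ℕ) (i : Fin n → X →ₗ[A] M) (p : Fin n → M →ₗ[A] X),
      ∑ j, p j ∘ₗ i j = LinearMap.id := by
  obtain ⟨n, i, p, hip⟩ := h
  refine ⟨n, fun j => LinearMap.proj j ∘ₗ i, fun j => p ∘ₗ LinearMap.single A (fun _ => M) j, ?_⟩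
  refine LinearMap.ext fun x => ?_
  have := LinearMap.congr_fun hip x
  simp only [LinearMap.comp_apply, LinearMap.id_apply, LinearMap.sum_apply] at this ⊢
  rw [← map_sum]
  conv_rhs => rw [← this]
  congr 1
  exact Finset.univ_sum_single (i x)

theorem InAdd.of_sum_comp {n : ℕ} (i : Fin n → X →ₗ[A] M) (p : Fin n → M →ₗ[A] X)
    (h : ∑ j, p j ∘ₗ i j = LinearMap.id) : InAdd A M X := by
  refine ⟨n, LinearMap.pi i, ∑ j, p j ∘ₗ LinearMap.proj j, ?_⟩
  rw [← h]
  refine LinearMap.ext fun x => ?_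
  simp

theorem InAdd.of_sum_comp' {ι : Type*} [Fintype ι] (i : ι → X →ₗ[A] M) (p : ι → M →ₗ[A] X)
    (h : ∑ j, p j ∘ₗ i j = LinearMap.id) : InAdd A M X := by
  let e := Fintype.equivFin ι
  refine InAdd.of_sum_comp (fun j => i (e.symm j)) (fun j => p (e.symm j)) ?_
  rw [← h]
  exact Equiv.sum_comp e.symm fun j => p j ∘ₗ i j

theorem InAdd.refl (A M : Type u) [Ring A] [AddCommGroup M] [Module A M] : InAdd A M M :=
  .of_sum_comp' (ι := Unit) (fun _ => LinearMap.id) (fun _ => LinearMap.id) (by ext; simp)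

theorem InAdd.pi (A M : Type u) [Ring A] [AddCommGroup M] [Module A M] (n : ℕ) :
    InAdd A M (Fin n → M) :=
  ⟨n, LinearMap.id, LinearMap.id, rfl⟩

theorem InAdd.trans (h : InAdd A L M) (h' : InAdd A M N) : InAdd A L N := by
  obtain ⟨n, i, p, h⟩ := h.exists_sum_comp
  obtain ⟨m, j, q, h'⟩ := h'.exists_sum_comp
  refine .of_sum_comp' (ι := Fin m × Fin n) (fun a => i a.2 ∘ₗ j a.1) (fun a => q a.1 ∘ₗ p a.2) ?_
  rw [← h', Fintype.sum_prod_type]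
  refine Finset.sum_congr rfl fun a _ => ?_
  conv_rhs => rw [← LinearMap.id_comp (j a), ← h]
  ext x
  simp

theorem InAdd.of_equiv_left (e : M ≃ₗ[A] N) (h : InAdd A M X) : InAdd A N X :=
  (InAdd.of_equiv e.symm (InAdd.refl A N)).trans h

theorem InAdd.zero [Subsingleton X] : InAdd A M X :=
  ⟨0, 0, 0, LinearMap.ext fun _ => Subsingleton.elim _ _⟩

theorem InAdd.finite {K : Type u} [Field K] [Algebra K A] [Module K M] [IsScalarTower K A M]
    [Module K X] [IsScalarTower K A X] [Module.Finite K M] (h : InAdd A M X) :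
    Module.Finite K X := by
  obtain ⟨n, i, p, h⟩ := h
  refine Module.Finite.of_surjective (p.restrictScalars K) fun x => ⟨i x, ?_⟩
  exact LinearMap.congr_fun h x

end InAdd

/-! ### Short exact sequences and vanishing of extension groups -/

/-- The sequence `0 → X → Y → Z → 0` is exact. -/
structure IsShortExact {A : Type u} [Ring A] {X Y Z : Type u}
    [AddCommGroup X] [Module A X] [AddCommGroup Y] [Module A Y] [AddCommGroup Z] [Module A Z]
    (f : X →ₗ[A] Y) (g : Y →ₗ[A] Z) : Prop where
  injective : Function.Injective f
  exact : Function.Exact f g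
  surjective : Function.Surjective g

/-- `Ext^i(X, Y) = 0` for all `i ≥ 1`. -/
def ExtVanish (A : Type u) [Ring A] (X Y : Type u) [AddCommGroup X] [Module A X]
    [AddCommGroup Y] [Module A Y] : Prop :=
  ∀ i : ℕ, 1 ≤ i → Subsingleton (Ext (ModuleCat.of A X) (ModuleCat.of A Y) i)

section ExtVanish

variable {A : Type u} [Ring A] {W X Y Z : Type u}
  [AddCommGroup W] [Module A W]
  [AddCommGroup X] [Module A X] [AddCommGroup Y] [Module A Y] [AddCommGroup Z] [Module A Z]

theorem ModuleCat.ofHom_sum {ι : Type*} [Fintype ι] (f : ι → X →ₗ[A] Y) :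
    ModuleCat.ofHom (∑ j, f j) = ∑ j, ModuleCat.ofHom (f j) := by
  ext x
  simp

theorem Ext.subsingleton_of_inAdd_left (h : InAdd A X W) {i : ℕ} {Z : ModuleCat.{u} A}
    (hX : Subsingleton (Ext (ModuleCat.of A X) Z i)) :
    Subsingleton (Ext (ModuleCat.of A W) Z i) := by
  obtain ⟨n, a, p, h⟩ := h.exists_sum_comp
  refine subsingleton_of_forall_eq 0 fun x => ?_
  rw [← Ext.mk₀_id_comp x, ← ModuleCat.ofHom_id, ← h, ModuleCat.ofHom_sum, Ext.mk₀_sum,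
    Ext.sum_comp]
  refine Finset.sum_eq_zero fun j _ => ?_
  rw [ModuleCat.ofHom_comp, ← Ext.mk₀_comp_mk₀_assoc,
    Subsingleton.elim ((Ext.mk₀ (ModuleCat.ofHom (p j))).comp x (zero_add i)) 0, Ext.comp_zero]

theorem Ext.subsingleton_of_inAdd_right (h : InAdd A X W) {i : ℕ} {Z : ModuleCat.{u} A}
    (hX : Subsingleton (Ext Z (ModuleCat.of A X) i)) :
    Subsingleton (Ext Z (ModuleCat.of A W) i) := by
  obtain ⟨n, a, p, h⟩ := h.exists_sum_comp
  refine subsingleton_of_forall_eq 0 fun x => ?_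
  rw [← Ext.comp_mk₀_id x, ← ModuleCat.ofHom_id, ← h, ModuleCat.ofHom_sum, Ext.mk₀_sum,
    Ext.comp_sum]
  refine Finset.sum_eq_zero fun j _ => ?_
  rw [ModuleCat.ofHom_comp, ← Ext.mk₀_comp_mk₀, ← Ext.comp_assoc_of_third_deg_zero,
    Subsingleton.elim (x.comp (Ext.mk₀ (ModuleCat.ofHom (a j))) (add_zero i)) 0, Ext.zero_comp]

theorem ExtVanish.of_inAdd_left (h : InAdd A X W) (hX : ExtVanish A X Z) : ExtVanish A W Z :=
  fun i hi => Ext.subsingleton_of_inAdd_left h (hX i hi)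

theorem ExtVanish.of_inAdd_right (h : InAdd A X W) (hX : ExtVanish A Z X) : ExtVanish A Z W :=
  fun i hi => Ext.subsingleton_of_inAdd_right h (hX i hi)

theorem ExtVanish.of_equiv_left (e : X ≃ₗ[A] W) (hX : ExtVanish A X Z) : ExtVanish A W Z :=
  hX.of_inAdd_left ((InAdd.refl A X).of_equiv e)

theorem ExtVanish.of_equiv_right (e : X ≃ₗ[A] W) (hX : ExtVanish A Z X) : ExtVanish A Z W :=
  hX.of_inAdd_right ((InAdd.refl A X).of_equiv e)

theorem ExtVanish.of_injective (A : Type u) [Ring A] (X Y : Type u) [AddCommGroup X] [Module A X]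
    [AddCommGroup Y] [Module A Y] (h : Module.Injective A Y) : ExtVanish A X Y := by
  intro i hi
  have := (Module.injective_iff_injective_object A Y).mp h
  obtain ⟨i, rfl⟩ : ∃ j, i = j + 1 := ⟨i - 1, by omega⟩
  exact Ext.subsingleton_of_injective _ _ i

variable {f : X →ₗ[A] Y} {g : Y →ₗ[A] Z}

namespace IsShortExact

theorem comp_eq_zero (h : IsShortExact f g) : g ∘ₗ f = 0 :=
  h.exact.linearMap_comp_eq_zero

/-- The short complex of modules associated with a short exact sequence. -/
abbrev shortComplex (h : IsShortExact f g) : ShortComplex (ModuleCat.{u} A) :=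
  ShortComplex.mk (ModuleCat.ofHom f) (ModuleCat.ofHom g)
    (by rw [← ModuleCat.ofHom_comp, h.comp_eq_zero]; rfl)

theorem shortExact (h : IsShortExact f g) : h.shortComplex.ShortExact where
  exact := (ShortComplex.ShortExact.moduleCat_exact_iff_function_exact _).mpr h.exact
  mono_f := (ModuleCat.mono_iff_injective _).mpr h.injective
  epi_g := (ModuleCat.epi_iff_surjective _).mpr h.surjective

theorem subsingleton_ext₃ (h : IsShortExact f g) (W : ModuleCat.{u} A) {i : ℕ}
    (hY : Subsingleton (Ext W (ModuleCat.of A Y) i))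
    (hX : Subsingleton (Ext W (ModuleCat.of A X) (i + 1))) :
    Subsingleton (Ext W (ModuleCat.of A Z) i) := by
  refine subsingleton_of_forall_eq 0 fun x => ?_
  obtain ⟨y, rfl⟩ := Ext.covariant_sequence_exact₃ W h.shortExact x rfl (Subsingleton.elim _ _)
  rw [Subsingleton.elim y 0, Ext.zero_comp]

theorem subsingleton_ext₁ (h : IsShortExact f g) (W : ModuleCat.{u} A) {i : ℕ}
    (hZ : Subsingleton (Ext W (ModuleCat.of A Z) i))
    (hY : Subsingleton (Ext W (ModuleCat.of A Y) (i + 1))) :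
    Subsingleton (Ext W (ModuleCat.of A X) (i + 1)) := by
  refine subsingleton_of_forall_eq 0 fun x => ?_
  obtain ⟨y, rfl⟩ := Ext.covariant_sequence_exact₁ W h.shortExact x (Subsingleton.elim _ _) rfl
  rw [Subsingleton.elim y 0, Ext.zero_comp]

theorem subsingleton_ext₃' (h : IsShortExact f g) (W : ModuleCat.{u} A) {i : ℕ}
    (hX : Subsingleton (Ext (ModuleCat.of A X) W i))
    (hY : Subsingleton (Ext (ModuleCat.of A Y) W (i + 1))) :
    Subsingleton (Ext (ModuleCat.of A Z) W (i + 1)) := by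
  refine subsingleton_of_forall_eq 0 fun x => ?_
  obtain ⟨y, rfl⟩ := Ext.contravariant_sequence_exact₃ h.shortExact W x (Subsingleton.elim _ _)
    (add_comm 1 i)
  rw [Subsingleton.elim y 0, Ext.comp_zero]

theorem subsingleton_ext₁' (h : IsShortExact f g) (W : ModuleCat.{u} A) {i : ℕ}
    (hY : Subsingleton (Ext (ModuleCat.of A Y) W i))
    (hZ : Subsingleton (Ext (ModuleCat.of A Z) W (i + 1))) :
    Subsingleton (Ext (ModuleCat.of A X) W i) := by
  refine subsingleton_of_forall_eq 0 fun x => ?_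
  obtain ⟨y, rfl⟩ := Ext.contravariant_sequence_exact₁ h.shortExact W x (add_comm 1 i)
    (Subsingleton.elim _ _)
  rw [Subsingleton.elim y 0, Ext.comp_zero]

theorem exists_lift (h : IsShortExact f g)
    (hX : Subsingleton (Ext (ModuleCat.of A W) (ModuleCat.of A X) 1)) (b : W →ₗ[A] Z) :
    ∃ c : W →ₗ[A] Y, g ∘ₗ c = b := by
  obtain ⟨y, hy⟩ := Ext.covariant_sequence_exact₃ (ModuleCat.of A W) h.shortExact
    (Ext.mk₀ (ModuleCat.ofHom b)) rfl (Subsingleton.elim _ _)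
  obtain ⟨c, rfl⟩ := (Ext.mk₀_bijective _ _).2 y
  rw [Ext.mk₀_comp_mk₀] at hy
  refine ⟨c.hom, ?_⟩
  have := (Ext.mk₀_bijective _ _).1 hy
  exact congrArg ModuleCat.Hom.hom this

theorem extVanish₃ (h : IsShortExact f g) (hX : ExtVanish A W X) (hY : ExtVanish A W Y) :
    ExtVanish A W Z :=
  fun i hi => h.subsingleton_ext₃ _ (hY i hi) (hX (i + 1) (by omega))

/-- The connecting map `Hom(W, Z) → Ext^1(W, X)` is onto because `Ext^1(W, Y) = 0`, and it kills
every map that lifts to `Y`. -/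
theorem subsingleton_ext_one_of_lift (h : IsShortExact f g)
    (hY : Subsingleton (Ext (ModuleCat.of A W) (ModuleCat.of A Y) 1))
    (hl : ∀ b : W →ₗ[A] Z, ∃ c : W →ₗ[A] Y, g ∘ₗ c = b) :
    Subsingleton (Ext (ModuleCat.of A W) (ModuleCat.of A X) 1) := by
  refine subsingleton_of_forall_eq 0 fun x => ?_
  obtain ⟨y, rfl⟩ := Ext.covariant_sequence_exact₁ (ModuleCat.of A W) h.shortExact x
    (Subsingleton.elim _ _) rfl
  obtain ⟨b, rfl⟩ := (Ext.mk₀_bijective _ _).2 y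
  obtain ⟨c, hc⟩ := hl b.hom
  have : b = ModuleCat.ofHom c ≫ h.shortComplex.g := by
    ext x
    exact (LinearMap.congr_fun hc x).symm
  rw [this, ← Ext.mk₀_comp_mk₀, Ext.comp_assoc_of_second_deg_zero,
    ShortComplex.ShortExact.comp_extClass, Ext.comp_zero]

theorem subsingleton_ext_one_of_extend (h : IsShortExact f g)
    (hY : Subsingleton (Ext (ModuleCat.of A Y) (ModuleCat.of A W) 1))
    (hl : ∀ b : X →ₗ[A] W, ∃ c : Y →ₗ[A] W, c ∘ₗ f = b) :
    Subsingleton (Ext (ModuleCat.of A Z) (ModuleCat.of A W) 1) := by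
  refine subsingleton_of_forall_eq 0 fun x => ?_
  obtain ⟨y, rfl⟩ := Ext.contravariant_sequence_exact₃ h.shortExact (ModuleCat.of A W) x
    (Subsingleton.elim _ _) (add_zero 1)
  obtain ⟨b, rfl⟩ := (Ext.mk₀_bijective _ _).2 y
  obtain ⟨c, hc⟩ := hl b.hom
  have : b = h.shortComplex.f ≫ ModuleCat.ofHom c := by
    ext x
    exact (LinearMap.congr_fun hc x).symm
  rw [this, ← Ext.mk₀_comp_mk₀, ← Ext.comp_assoc_of_second_deg_zero,
    ShortComplex.ShortExact.extClass_comp, Ext.zero_comp]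

theorem extVanish₁_of_lift (h : IsShortExact f g) (hY : ExtVanish A W Y) (hZ : ExtVanish A W Z)
    (hl : ∀ b : W →ₗ[A] Z, ∃ c : W →ₗ[A] Y, g ∘ₗ c = b) : ExtVanish A W X := by
  intro i hi
  rcases Nat.lt_or_ge 1 i with hi' | hi'
  · obtain ⟨i, rfl⟩ : ∃ j, i = j + 1 := ⟨i - 1, by omega⟩
    exact h.subsingleton_ext₁ _ (hZ i (by omega)) (hY _ hi)
  · obtain rfl : i = 1 := by omega
    exact h.subsingleton_ext_one_of_lift (hY 1 le_rfl) hl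

theorem extVanish₃_of_extend (h : IsShortExact f g) (hX : ExtVanish A X W) (hY : ExtVanish A Y W)
    (hl : ∀ b : X →ₗ[A] W, ∃ c : Y →ₗ[A] W, c ∘ₗ f = b) : ExtVanish A Z W := by
  intro i hi
  rcases Nat.lt_or_ge 1 i with hi' | hi'
  · obtain ⟨i, rfl⟩ : ∃ j, i = j + 1 := ⟨i - 1, by omega⟩
    exact h.subsingleton_ext₃' _ (hX i (by omega)) (hY _ hi)
  · obtain rfl : i = 1 := by omega
    exact h.subsingleton_ext_one_of_extend (hY 1 le_rfl) hl

end IsShortExact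

/-- The short exact sequence of an injective map and its cokernel. -/
theorem isShortExact_mkQ (f : X →ₗ[A] Y) (hf : Function.Injective f) :
    IsShortExact f (LinearMap.range f).mkQ where
  injective := hf
  exact := LinearMap.exact_map_mkQ_range f
  surjective := Submodule.mkQ_surjective _

theorem Module.Injective.of_inAdd (h : InAdd A Y X) (hY : Module.Injective A Y) :
    Module.Injective A X := by
  refine (Module.injective_iff_injective_object A X).mpr
    (injective_iff_subsingleton_ext_one.mpr fun W => ?_)
  exact Ext.subsingleton_of_inAdd_right h (ExtVanish.of_injective A W Y hY 1 le_rfl)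

theorem hasInjectiveDimensionLE_of_equiv (e : X ≃ₗ[A] Y) {n : ℕ}
    (h : HasInjectiveDimensionLE (ModuleCat.of A X) n) :
    HasInjectiveDimensionLE (ModuleCat.of A Y) n :=
  hasInjectiveDimensionLT_of_iso e.toModuleIso (n + 1)

end ExtVanish

/-! ### Exact sequences -/

section Chains

variable {K : Type u} [Field K] {A : Type u} [Ring A] [Algebra K A]

/-- There is an exact sequence `0 → X → P_1 → ⋯ → P_n → Y → 0` with all `P_i` in `add P`. -/
def HasChain (P : FDModule K A) : ℕ → FDModule K A → FDModule K A → Prop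
  | 0, X, Y => Nonempty (X ≃ₗ[A] Y)
  | n + 1, X, Y => ∃ (Q X' : FDModule K A) (f : X →ₗ[A] Q) (g : Q →ₗ[A] X'),
      InAdd A P Q ∧ IsShortExact f g ∧ HasChain P n X' Y

variable {P : FDModule K A}

theorem IsShortExact.of_equiv_left {X X' Y Z : Type u} [AddCommGroup X] [Module A X]
    [AddCommGroup X'] [Module A X'] [AddCommGroup Y] [Module A Y] [AddCommGroup Z] [Module A Z]
    {f : X →ₗ[A] Y} {g : Y →ₗ[A] Z} (h : IsShortExact f g) (e : X' ≃ₗ[A] X) :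
    IsShortExact (f ∘ₗ e.toLinearMap) g where
  injective := h.injective.comp e.injective
  exact := by
    intro y
    rw [h.exact y]
    exact ⟨fun ⟨x, hx⟩ => ⟨e.symm x, by simpa using hx⟩, fun ⟨x, hx⟩ => ⟨e x, hx⟩⟩
  surjective := h.surjective

theorem IsShortExact.of_equiv_right {X Y Z Z' : Type u} [AddCommGroup X] [Module A X]
    [AddCommGroup Y] [Module A Y] [AddCommGroup Z] [Module A Z] [AddCommGroup Z'] [Module A Z']
    {f : X →ₗ[A] Y} {g : Y →ₗ[A] Z} (h : IsShortExact f g) (e : Z ≃ₗ[A] Z') :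
    IsShortExact f (e.toLinearMap ∘ₗ g) where
  injective := h.injective
  exact := by
    intro y
    rw [← h.exact y]
    simp
  surjective := e.surjective.comp h.surjective

theorem HasChain.of_equiv_left {n : ℕ} {X X' Y : FDModule K A} (e : X ≃ₗ[A] X')
    (h : HasChain P n X Y) : HasChain P n X' Y := by
  cases n with
  | zero => exact h.map fun e' => e.symm.trans e'
  | succ n =>
    obtain ⟨Q, Z, f, g, hQ, hfg, h⟩ := h
    exact ⟨Q, Z, _, g, hQ, hfg.of_equiv_left e.symm, h⟩

theorem HasChain.of_equiv_right {n : ℕ} {X Y Y' : FDModule K A} (e : Y ≃ₗ[A] Y')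
    (h : HasChain P n X Y) : HasChain P n X Y' := by
  induction n generalizing X with
  | zero => exact h.map fun e' => e'.trans e
  | succ n ih =>
    obtain ⟨Q, Z, f, g, hQ, hfg, h⟩ := h
    exact ⟨Q, Z, f, g, hQ, hfg, ih h⟩

/-- Chains are built from the left end, but a contravariant functor reverses them, so they must also
grow at the right end. -/
theorem HasChain.snoc {n : ℕ} {X Y Q Z : FDModule K A} (h : HasChain P n X Y)
    {f : Y →ₗ[A] Q} {g : Q →ₗ[A] Z} (hQ : InAdd A P Q) (hfg : IsShortExact f g) :
    HasChain P (n + 1) X Z := by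
  induction n generalizing X with
  | zero =>
    obtain ⟨e⟩ := h
    exact ⟨Q, Z, _, g, hQ, hfg.of_equiv_left e, ⟨LinearEquiv.refl A Z⟩⟩
  | succ n ih =>
    obtain ⟨Q', X', f', g', hQ', hfg', h'⟩ := h
    exact ⟨Q', X', f', g', hQ', hfg', ih h'⟩

theorem HasChain.congr_add {P' : FDModule K A} (hP : InAdd A P' P) {n : ℕ} {X Y : FDModule K A}
    (h : HasChain P n X Y) : HasChain P' n X Y := by
  induction n generalizing X with
  | zero => exact h
  | succ n ih =>
    obtain ⟨Q, Z, f, g, hQ, hfg, h⟩ := h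
    exact ⟨Q, Z, f, g, hP.trans hQ, hfg, ih h⟩

section Tail

variable (Z : ℕ → FDModule K A) (d : ∀ i, Z i →ₗ[A] Z (i + 1))

/-- The terms of the sequence `Z 1 ⧸ Z 0 → Z 2 → Z 3 → ⋯`. -/
def tailObj : ℕ → FDModule K A
  | 0 => ⟨Z 1 ⧸ LinearMap.range (d 0)⟩
  | i + 1 => Z (i + 2)

/-- The maps of the sequence `Z 1 ⧸ Z 0 → Z 2 → Z 3 → ⋯`. -/
def tailMap (h : LinearMap.range (d 0) ≤ LinearMap.ker (d 1)) :
    ∀ i, tailObj Z d i →ₗ[A] tailObj Z d (i + 1)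
  | 0 => (LinearMap.range (d 0)).liftQ (d 1) h
  | i + 1 => d (i + 2)

variable {Z d}

theorem IsLeftExactSeq.range_le {n : ℕ} (h : IsLeftExactSeq (n + 1) Z d) :
    LinearMap.range (d 0) ≤ LinearMap.ker (d 1) :=
  (LinearMap.exact_iff.mp (h.2 0 (Nat.succ_pos n))).ge

theorem IsLeftExactSeq.tail {n : ℕ} (h : IsLeftExactSeq (n + 1) Z d) :
    IsLeftExactSeq n (tailObj Z d) (tailMap Z d h.range_le) := by
  have h0 : Function.Exact (d 0) (d 1) := h.2 0 (Nat.succ_pos n)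
  refine ⟨?_, ?_⟩
  · change Function.Injective ((LinearMap.range (d 0)).liftQ (d 1) h.range_le)
    rw [← LinearMap.ker_eq_bot, Submodule.ker_liftQ, LinearMap.exact_iff.mp h0,
      Submodule.mkQ_map_self]
  · intro i hi
    cases i with
    | zero =>
      change Function.Exact ((LinearMap.range (d 0)).liftQ (d 1) h.range_le) (d 2)
      have h1 : Function.Exact (d 1) (d 2) := h.2 1 (by omega)
      rw [LinearMap.exact_iff] at h1 ⊢
      rw [h1, Submodule.range_liftQ]
    | succ i => exact h.2 (i + 2) (by omega)

/-- The terms of the sequence `X → Q → Z 1 → Z 2 → ⋯`. -/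
def consObj (X Q : FDModule K A) (Z : ℕ → FDModule K A) : ℕ → FDModule K A
  | 0 => X
  | 1 => Q
  | i + 2 => Z (i + 1)

/-- The maps of the sequence `X → Q → Z 1 → Z 2 → ⋯`. -/
def consMap {X Q : FDModule K A} (f : X →ₗ[A] Q) (g : Q →ₗ[A] Z 0)
    (d : ∀ i, Z i →ₗ[A] Z (i + 1)) : ∀ i, consObj X Q Z i →ₗ[A] consObj X Q Z (i + 1)
  | 0 => f
  | 1 => d 0 ∘ₗ g
  | i + 2 => d (i + 1)

theorem IsLeftExactSeq.cons {n : ℕ} (h : IsLeftExactSeq n Z d) {X Q : FDModule K A}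
    {f : X →ₗ[A] Q} {g : Q →ₗ[A] Z 0} (hfg : IsShortExact f g) :
    IsLeftExactSeq (n + 1) (consObj X Q Z) (consMap f g d) := by
  refine ⟨hfg.injective, ?_⟩
  rintro (_ | _ | i) hi
  · change Function.Exact f (d 0 ∘ₗ g)
    rw [LinearMap.exact_iff, LinearMap.ker_comp, LinearMap.ker_eq_bot.mpr h.1]
    exact LinearMap.exact_iff.mp hfg.exact
  · change Function.Exact (d 0 ∘ₗ g) (d 1)
    rw [LinearMap.exact_iff, LinearMap.range_comp, LinearMap.range_eq_top.mpr hfg.surjective,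
      Submodule.map_top]
    exact LinearMap.exact_iff.mp (h.2 0 (by omega))
  · exact h.2 (i + 1) (by omega)

/-- The terms of the sequence `X → Y → 0 → 0 → ⋯`. -/
def pairObj (X Y : FDModule K A) : ℕ → FDModule K A
  | 0 => X
  | 1 => Y
  | _ + 2 => ⟨PUnit⟩

/-- The maps of the sequence `X → Y → 0 → 0 → ⋯`. -/
def pairMap {X Y : FDModule K A} (f : X →ₗ[A] Y) :
    ∀ i, pairObj X Y i →ₗ[A] pairObj X Y (i + 1)
  | 0 => f
  | 1 => 0
  | _ + 2 => 0

end Tail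

/-- Replacing `Z 0 → Z 1` by its cokernel shortens the sequence by one term. -/
theorem IsExactSeq.hasChain {n : ℕ} {Z : ℕ → FDModule K A} {d : ∀ i, Z i →ₗ[A] Z (i + 1)}
    (h : IsExactSeq n Z d) (hZ : ∀ i, 1 ≤ i → i ≤ n → InAdd A P (Z i)) :
    HasChain P n (Z 0) (Z (n + 1)) := by
  induction n generalizing Z with
  | zero => exact ⟨LinearEquiv.ofBijective (d 0) ⟨h.1.1, h.2⟩⟩
  | succ n ih =>
    refine ⟨Z 1, tailObj Z d 0, d 0, (LinearMap.range (d 0)).mkQ, hZ 1 le_rfl (by omega),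
      isShortExact_mkQ _ h.1.1, ih (Z := tailObj Z d) (d := tailMap Z d h.1.range_le)
        ⟨h.1.tail, ?_⟩ ?_⟩
    · cases n with
      | zero =>
        change Function.Surjective ((LinearMap.range (d 0)).liftQ (d 1) h.1.range_le)
        rw [← LinearMap.range_eq_top, Submodule.range_liftQ, LinearMap.range_eq_top]
        exact h.2
      | succ n => exact h.2
    · intro i hi hi'
      obtain ⟨i, rfl⟩ : ∃ j, i = j + 1 := ⟨i - 1, by omega⟩
      exact hZ (i + 2) (by omega) (by omega)

theorem HasChain.exists_isExactSeq {n : ℕ} {X Y : FDModule K A} (h : HasChain P n X Y) :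
    ∃ (Z : ℕ → FDModule K A) (d : ∀ i, Z i →ₗ[A] Z (i + 1)), IsExactSeq n Z d ∧
      Nonempty (Z 0 ≃ₗ[A] X) ∧ Nonempty (Z (n + 1) ≃ₗ[A] Y) ∧
        ∀ i, 1 ≤ i → i ≤ n → InAdd A P (Z i) := by
  induction n generalizing X with
  | zero =>
    obtain ⟨e⟩ := h
    refine ⟨pairObj X Y, pairMap e.toLinearMap, ⟨⟨e.injective, ?_⟩, e.surjective⟩,
      ⟨LinearEquiv.refl A X⟩, ⟨LinearEquiv.refl A Y⟩, ?_⟩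
    · intro i hi; omega
    · intro i hi hi'; omega
  | succ n ih =>
    obtain ⟨Q, X', f, g, hQ, hfg, h⟩ := h
    obtain ⟨Z, d, hZ, ⟨e⟩, hY, hP⟩ := ih h
    refine ⟨consObj X Q Z, consMap f (e.symm.toLinearMap ∘ₗ g) d,
      ⟨hZ.1.cons (hfg.of_equiv_right e.symm), ?_⟩, ⟨LinearEquiv.refl A X⟩, hY, ?_⟩
    · cases n with
      | zero => exact hZ.2.comp (hfg.of_equiv_right e.symm).surjective
      | succ n => exact hZ.2
    · rintro (_ | _ | i) hi hi'
      · omega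
      · exact hQ
      · exact hP (i + 1) (by omega) (by omega)

end Chains

/-! ### Splicing approximations into `cogen`, and dimension shifting -/

section Cogen

variable {K : Type u} [Field K] {A : Type u} [Ring A] [Algebra K A]
  {M Q X X' : FDModule K A}

theorem mem_cogen_zero {f : X →ₗ[A] Q} (hf : Function.Injective f) (hQ : InAdd A M Q)
    (hl : ∀ b : X →ₗ[A] M, ∃ c : Q →ₗ[A] M, c ∘ₗ f = b) : X ∈ cogen 0 M := by
  refine ⟨pairObj X Q, pairMap f, ⟨LinearEquiv.refl A X⟩, ?_, ⟨hf, ?_⟩, ⟨hl, ?_⟩⟩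
  · intro i hi
    obtain rfl : i = 0 := by omega
    exact hQ
  · intro i hi; omega
  · intro i hi; omega

/-- Splicing keeps `Hom(-, M)` exact: a map `Q → M` that vanishes on `X` descends to `X'` and then
extends along the first map of the sequence for `X'`. -/
theorem mem_cogen_succ {n : ℕ} {f : X →ₗ[A] Q} {g : Q →ₗ[A] X'} (hfg : IsShortExact f g)
    (hQ : InAdd A M Q) (hl : ∀ b : X →ₗ[A] M, ∃ c : Q →ₗ[A] M, c ∘ₗ f = b)
    (hX' : X' ∈ cogen n M) : X ∈ cogen (n + 1) M := by
  obtain ⟨Z, d, ⟨e⟩, hZ, hd, hM⟩ := hX'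
  have hfg' := hfg.of_equiv_right e.symm
  refine ⟨consObj X Q Z, consMap f (e.symm.toLinearMap ∘ₗ g) d, ⟨LinearEquiv.refl A X⟩, ?_,
    hd.cons hfg', ⟨hl, ?_⟩⟩
  · rintro (_ | i) hi
    · exact hQ
    · exact hZ i (by omega)
  · rintro (_ | i) hi
    · change Function.Exact (fun h : Z 1 →ₗ[A] M => h ∘ₗ (d 0 ∘ₗ (e.symm.toLinearMap ∘ₗ g)))
        (fun h : Q →ₗ[A] M => h ∘ₗ f)
      intro h
      constructor
      · intro hh
        have hle : LinearMap.ker (e.symm.toLinearMap ∘ₗ g) ≤ LinearMap.ker h := by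
          rw [LinearMap.exact_iff.mp hfg'.exact, LinearMap.range_le_ker_iff]
          exact hh
        obtain ⟨h', rfl⟩ : ∃ h' : Z 0 →ₗ[A] M, h' ∘ₗ (e.symm.toLinearMap ∘ₗ g) = h := by
          refine ⟨(LinearMap.ker (e.symm.toLinearMap ∘ₗ g)).liftQ h hle ∘ₗ
            ((e.symm.toLinearMap ∘ₗ g).quotKerEquivOfSurjective hfg'.surjective).symm.toLinearMap,
            ?_⟩
          refine LinearMap.ext fun x => ?_
          have := LinearMap.quotKerEquivOfSurjective_symm_apply
            (e.symm.toLinearMap ∘ₗ g) hfg'.surjective x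
          rw [LinearMap.comp_apply, LinearMap.comp_apply, LinearEquiv.coe_coe, this]
          rfl
        obtain ⟨h'', rfl⟩ := hM.1 h'
        exact ⟨h'', rfl⟩
      · rintro ⟨h', rfl⟩
        refine LinearMap.ext fun x => ?_
        have := hfg'.exact.apply_apply_eq_zero x
        simp only [LinearMap.comp_apply] at this ⊢
        rw [this, map_zero, map_zero]
        rfl
    · cases i with
      | zero =>
        change Function.Exact (fun h : Z 2 →ₗ[A] M => h ∘ₗ d 1)
          (fun h : Z 1 →ₗ[A] M => h ∘ₗ (d 0 ∘ₗ (e.symm.toLinearMap ∘ₗ g)))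
        intro h
        rw [← hM.2 0 (by omega) h, ← LinearMap.comp_assoc]
        constructor
        · intro hh
          refine LinearMap.ext fun x => ?_
          obtain ⟨y, rfl⟩ := hfg'.surjective x
          exact LinearMap.congr_fun hh y
        · intro hh
          exact LinearMap.ext fun x => LinearMap.congr_fun hh _
      | succ i => exact hM.2 (i + 1) (by omega)

/-- Shifting along the cokernels embeds `Ext^i(Z 0, W)` into `Ext^{i+n+1}` of the last cokernel,
where `hW` applies. The offset `m` records the degrees already shifted in the induction. -/
theorem IsLeftExactSeq.subsingleton_ext {W : ModuleCat.{u} A} {n : ℕ} (m : ℕ)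
    {Z : ℕ → FDModule K A} {d : ∀ i, Z i →ₗ[A] Z (i + 1)} (h : IsLeftExactSeq n Z d)
    (hZ : ∀ i, i ≤ n → ∀ j, 1 ≤ j → Subsingleton (Ext (Z (i + 1)).toModuleCat W j))
    (hW : ∀ (X : ModuleCat.{u} A) (j : ℕ), m + n + 2 ≤ j → Subsingleton (Ext X W j))
    (i : ℕ) (hi : m + 1 ≤ i) : Subsingleton (Ext (Z 0).toModuleCat W i) := by
  induction n generalizing Z m i with
  | zero =>
    exact (isShortExact_mkQ _ h.1).subsingleton_ext₁' W (hZ 0 le_rfl i (by omega))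
      (hW _ _ (by omega))
  | succ n ih =>
    refine (isShortExact_mkQ _ h.1).subsingleton_ext₁' W (hZ 0 (by omega) i (by omega)) ?_
    exact ih (m + 1) h.tail (fun j hj => hZ (j + 1) (by omega))
      (fun X j hj => hW X j (by omega)) (i + 1) (by omega)

end Cogen

/-! ### The injective cogenerator -/

section DualRegular

variable {K : Type u} [Field K] {A : Type u} [Ring A] [Algebra K A]

/-- An element of `D A` as a linear form. -/
noncomputable def DualRegular.toDual : DualRegular K A ≃ₗ[K] Module.Dual K A :=
  LinearEquiv.refl K (A →ₗ[K] K)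

@[simp]
theorem DualRegular.toDual_smul (a : A) (φ : DualRegular K A) (x : A) :
    DualRegular.toDual (a • φ) x = DualRegular.toDual φ (x * a) := rfl

theorem DualRegular.ext {φ ψ : DualRegular K A}
    (h : ∀ x, DualRegular.toDual φ x = DualRegular.toDual ψ x) : φ = ψ :=
  LinearMap.ext h

section

variable {X : Type u} [AddCommGroup X] [Module K X] [Module A X] [IsScalarTower K A X]

/-- The `A`-linear map `X → D A` corresponding to a linear form on `X`. -/
noncomputable def dualRegularLift (ξ : Module.Dual K X) : X →ₗ[A] DualRegular K A where
  toFun x := DualRegular.toDual.symm (ξ ∘ₗ (LinearMap.toSpanSingleton A X x).restrictScalars K)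
  map_add' x y := DualRegular.ext fun a => by
    simp [LinearMap.toSpanSingleton_add]
  map_smul' b x := DualRegular.ext fun a => by
    simp [mul_smul]

@[simp]
theorem toDual_dualRegularLift (ξ : Module.Dual K X) (x : X) (a : A) :
    DualRegular.toDual (dualRegularLift (A := A) ξ x) a = ξ (a • x) := rfl

/-- This is the adjunction `Hom_A(X, D A) ≅ D X`: the linear form is `x ↦ f(x)(1)`. -/
theorem exists_dualRegularLift_eq (f : X →ₗ[A] DualRegular K A) :
    ∃ ξ : Module.Dual K X, dualRegularLift ξ = f := by
  refine ⟨(LinearMap.toSpanSingleton K K 1).comp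
    ((Module.Dual.eval K A 1) ∘ₗ DualRegular.toDual.toLinearMap ∘ₗ f.restrictScalars K), ?_⟩
  refine LinearMap.ext fun x => DualRegular.ext fun a => ?_
  simp

end

/-- Through `Hom_A(-, D A) ≅ D`, the problem becomes extending a linear form, which is possible
because an injection splits over `K`. -/
theorem exists_extend_dualRegular {X Y : Type u} [AddCommGroup X] [Module K X] [Module A X]
    [IsScalarTower K A X] [AddCommGroup Y] [Module K Y] [Module A Y] [IsScalarTower K A Y]
    (f : X →ₗ[A] Y) (hf : Function.Injective f) (g : X →ₗ[A] DualRegular K A) :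
    ∃ h : Y →ₗ[A] DualRegular K A, h ∘ₗ f = g := by
  obtain ⟨ξ, rfl⟩ := exists_dualRegularLift_eq g
  obtain ⟨r, hr⟩ := (f.restrictScalars K).exists_leftInverse_of_injective
    (LinearMap.ker_eq_bot.mpr hf)
  refine ⟨dualRegularLift (ξ ∘ₗ r), LinearMap.ext fun x => DualRegular.ext fun a => ?_⟩
  have := LinearMap.congr_fun hr (a • x)
  simp only [LinearMap.comp_apply, LinearMap.restrictScalars_apply, map_smul,
    LinearMap.id_apply] at this
  simp [this]

theorem injective_dualRegular : Module.Injective A (DualRegular K A) where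
  out X Y _ _ _ _ f hf g := by
    -- The test modules for injectivity carry only an `A`-action, so their `K`-action is obtained by
    -- restriction.
    let := Module.compHom X (algebraMap K A)
    let := Module.compHom Y (algebraMap K A)
    have : IsScalarTower K A X := ⟨fun c a x => by
      rw [Algebra.smul_def, mul_smul]; rfl⟩
    have : IsScalarTower K A Y := ⟨fun c a x => by
      rw [Algebra.smul_def, mul_smul]; rfl⟩
    obtain ⟨h, hh⟩ := exists_extend_dualRegular f hf g
    exact ⟨h, LinearMap.congr_fun hh⟩

theorem exists_injective_dualRegular (X : FDModule K A) :
    ∃ (n : ℕ) (f : X →ₗ[A] (Fin n → DualRegular K A)), Function.Injective f := by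
  let b := Module.finBasis K X
  refine ⟨_, LinearMap.pi fun j => dualRegularLift (b.coord j), fun x y h => ?_⟩
  refine b.ext_elem fun j => ?_
  have := congrArg (fun φ => DualRegular.toDual φ 1) (congrFun h j)
  simpa using this

theorem inAdd_dualRegular_of_injective {X : FDModule K A} (hX : Module.Injective A X) :
    InAdd A (DualRegular K A) X := by
  obtain ⟨n, f, hf⟩ := exists_injective_dualRegular X
  obtain ⟨g, hg⟩ := hX.out f hf LinearMap.id
  exact ⟨n, f, g, LinearMap.ext hg⟩

/-- Minimality plays no role: the cokernel of any embedding into copies of `D A` has its injective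
dimension bound lowered by one. -/
theorem exists_chain_of_hasInjectiveDimensionLE [Module.Finite K A] {n : ℕ} {X : FDModule K A}
    (hX : HasInjectiveDimensionLE X.toModuleCat n) :
    ∃ I : FDModule K A, InAdd A (DualRegular K A) I ∧
      HasChain (FDModule.dualRegular K A) n X I := by
  induction n generalizing X with
  | zero =>
    refine ⟨X, inAdd_dualRegular_of_injective ?_, ⟨LinearEquiv.refl A X⟩⟩
    exact (Module.injective_iff_injective_object A X).mpr
      (injective_iff_hasInjectiveDimensionLT_one.mpr hX)
  | succ n ih =>
    obtain ⟨m, f, hf⟩ := exists_injective_dualRegular X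
    have hse := isShortExact_mkQ f hf
    have hI : Module.Injective A (Fin m → DualRegular K A) :=
      .of_inAdd (.pi A _ m) injective_dualRegular
    have hI' := (Module.injective_iff_injective_object A _).mp hI
    obtain ⟨I, hI, h⟩ := ih (X := ⟨(Fin m → DualRegular K A) ⧸ LinearMap.range f⟩)
      ((hse.shortExact.hasInjectiveDimensionLT_X₃_iff n hI').mpr hX)
    exact ⟨I, hI, ⟨Fin m → DualRegular K A⟩, _, f, _, .pi A _ m, hse, h⟩

theorem HasChain.hasInjectiveDimensionLE {n : ℕ} {P X Y : FDModule K A} (h : HasChain P n X Y)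
    (hP : Module.Injective A P) (hY : Module.Injective A Y) :
    HasInjectiveDimensionLE X.toModuleCat n := by
  induction n generalizing X with
  | zero =>
    obtain ⟨e⟩ := h
    have := (Module.injective_iff_injective_object A Y).mp hY
    exact hasInjectiveDimensionLE_of_equiv (X := Y) e.symm
      (injective_iff_hasInjectiveDimensionLT_one.mp this)
  | succ n ih =>
    obtain ⟨Q, X', f, g, hQ, hfg, h⟩ := h
    have hI' := (Module.injective_iff_injective_object A Q).mp (.of_inAdd hQ hP)
    exact (hfg.shortExact.hasInjectiveDimensionLT_X₃_iff n hI').mp (ih h)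

end DualRegular

/-! ### The functor `D Hom(M, -)` -/

section DualHom

variable {K : Type u} [Field K] {A : Type u} [Ring A] [Algebra K A] (M : FDModule K A)
  {X Y Z : FDModule K A}

/-- An element of `D Hom(M, X)` as a linear form. -/
noncomputable def DualHom.toDual {M X : FDModule K A} :
    DualHom K M X ≃ₗ[K] Module.Dual K (M →ₗ[A] X) :=
  LinearEquiv.refl K ((M →ₗ[A] X) →ₗ[K] K)

variable {M} in
@[simp]
theorem DualHom.toDual_smul (γ : Module.End A M) (φ : DualHom K M X) (f : M →ₗ[A] X) :
    DualHom.toDual (γ • φ) f = DualHom.toDual φ (f ∘ₗ γ) := rfl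

variable {M} in
theorem DualHom.ext {φ ψ : DualHom K M X}
    (h : ∀ f, DualHom.toDual φ f = DualHom.toDual ψ f) : φ = ψ :=
  LinearMap.ext h

/-- Composition with `f : X → Y` as a linear map `Hom(M, X) → Hom(M, Y)`. -/
def postcomp (f : X →ₗ[A] Y) : (M →ₗ[A] X) →ₗ[K] (M →ₗ[A] Y) where
  toFun g := f ∘ₗ g
  map_add' g h := LinearMap.comp_add g h f
  map_smul' c g := LinearMap.ext fun x => LinearMap.map_smul_of_tower f c (g x)

@[simp]
theorem postcomp_apply (f : X →ₗ[A] Y) (g : M →ₗ[A] X) : postcomp M f g = f ∘ₗ g := rfl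

/-- The map `D Hom(M, Y) → D Hom(M, X)` induced by `f : X → Y`. -/
noncomputable def dualHomMap (f : X →ₗ[A] Y) :
    DualHom K M Y →ₗ[Module.End A M] DualHom K M X where
  toFun φ := DualHom.toDual.symm (DualHom.toDual φ ∘ₗ postcomp M f)
  map_add' _ _ := rfl
  map_smul' _ _ := rfl

@[simp]
theorem toDual_dualHomMap (f : X →ₗ[A] Y) (φ : DualHom K M Y) (g : M →ₗ[A] X) :
    DualHom.toDual (dualHomMap M f φ) g = DualHom.toDual φ (f ∘ₗ g) := rfl

theorem dualHomMap_injective (g : Y →ₗ[A] Z)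
    (hl : ∀ b : M →ₗ[A] Z, ∃ c : M →ₗ[A] Y, g ∘ₗ c = b) :
    Function.Injective (dualHomMap M g) := by
  intro φ ψ h
  refine DualHom.ext fun b => ?_
  obtain ⟨c, rfl⟩ := hl b
  exact congrArg (fun ξ => DualHom.toDual ξ c) h

theorem dualHomMap_surjective (f : X →ₗ[A] Y) (hf : Function.Injective f) :
    Function.Surjective (dualHomMap M f) := by
  intro φ
  obtain ⟨r, hr⟩ := (postcomp M f).exists_leftInverse_of_injective
    (LinearMap.ker_eq_bot.mpr fun g h hgh => LinearMap.ext fun x =>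
      hf (LinearMap.congr_fun hgh x))
  refine ⟨DualHom.toDual.symm (DualHom.toDual φ ∘ₗ r), DualHom.ext fun g => ?_⟩
  have := LinearMap.congr_fun hr g
  simp only [LinearMap.comp_apply, postcomp_apply, LinearMap.id_apply] at this
  simp [this]

theorem IsShortExact.exists_factor {f : X →ₗ[A] Y} {g : Y →ₗ[A] Z} (h : IsShortExact f g)
    {W : Type u} [AddCommGroup W] [Module A W] (a : W →ₗ[A] Y) (ha : g ∘ₗ a = 0) :
    ∃ b : W →ₗ[A] X, f ∘ₗ b = a := by
  let e := LinearEquiv.ofInjective f h.injective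
  have hr : ∀ w, a w ∈ LinearMap.range f := fun w => (h.exact (a w)).mp (LinearMap.congr_fun ha w)
  refine ⟨e.symm.toLinearMap ∘ₗ a.codRestrict _ hr, LinearMap.ext fun w => ?_⟩
  have := LinearEquiv.apply_symm_apply e (a.codRestrict _ hr w)
  exact congrArg Subtype.val this

theorem exists_dualHomMap_eq {f : X →ₗ[A] Y} {g : Y →ₗ[A] Z} (h : IsShortExact f g)
    (hl : ∀ b : M →ₗ[A] Z, ∃ c : M →ₗ[A] Y, g ∘ₗ c = b) {φ : DualHom K M Y}
    (hφ : dualHomMap M f φ = 0) : ∃ ψ, dualHomMap M g ψ = φ := by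
  obtain ⟨s, hs⟩ := (postcomp M g).exists_rightInverse_of_surjective
    (LinearMap.range_eq_top.mpr hl)
  refine ⟨DualHom.toDual.symm (DualHom.toDual φ ∘ₗ s), DualHom.ext fun a => ?_⟩
  have h1 := LinearMap.congr_fun hs (g ∘ₗ a)
  simp only [LinearMap.comp_apply, postcomp_apply, LinearMap.id_apply] at h1
  -- Both `s (g ∘ a)` and `a` become `g ∘ a` in `Hom(M, Z)`, so their difference factors through
  -- `f`, where `φ` vanishes.
  obtain ⟨b, hb⟩ := h.exists_factor (s (g ∘ₗ a) - a) (by rw [LinearMap.comp_sub, h1, sub_self])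
  have h2 : DualHom.toDual φ (f ∘ₗ b) = 0 := congrArg (fun ξ => DualHom.toDual ξ b) hφ
  rw [hb, map_sub, sub_eq_zero] at h2
  exact h2

theorem IsShortExact.dualHom {f : X →ₗ[A] Y} {g : Y →ₗ[A] Z} (h : IsShortExact f g)
    (hl : ∀ b : M →ₗ[A] Z, ∃ c : M →ₗ[A] Y, g ∘ₗ c = b) :
    IsShortExact (dualHomMap M g) (dualHomMap M f) where
  injective := dualHomMap_injective M g hl
  surjective := dualHomMap_surjective M f h.injective
  exact := by
    intro φ
    refine ⟨fun hφ => exists_dualHomMap_eq M h hl hφ, ?_⟩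
    rintro ⟨ψ, rfl⟩
    refine DualHom.ext fun a => ?_
    rw [toDual_dualHomMap, toDual_dualHomMap, ← LinearMap.comp_assoc, h.comp_eq_zero,
      LinearMap.zero_comp, map_zero, map_zero]
    rfl

/-- The isomorphism `D Hom(M, Y) ≃ D Hom(M, X)` induced by `X ≃ Y`. -/
noncomputable def dualHomCongr (e : X ≃ₗ[A] Y) :
    DualHom K M Y ≃ₗ[Module.End A M] DualHom K M X :=
  .ofLinearMap (dualHomMap M e.toLinearMap) (dualHomMap M e.symm.toLinearMap)
    (by
      refine LinearMap.ext fun φ => DualHom.ext fun g => ?_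
      simp [← LinearMap.comp_assoc])
    (by
      refine LinearMap.ext fun φ => DualHom.ext fun g => ?_
      simp [← LinearMap.comp_assoc])

variable {M} in
theorem InAdd.dualHom (h : InAdd A X Y) :
    InAdd (Module.End A M) (DualHom K M X) (DualHom K M Y) := by
  obtain ⟨n, i, p, h⟩ := h.exists_sum_comp
  refine .of_sum_comp (fun j => dualHomMap M (p j)) (fun j => dualHomMap M (i j)) ?_
  refine LinearMap.ext fun φ => DualHom.ext fun g => ?_
  simp only [LinearMap.sum_apply, map_sum, LinearMap.comp_apply, toDual_dualHomMap,
    LinearMap.id_apply]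
  rw [← map_sum]
  congr 1
  ext x
  have := LinearMap.congr_fun h (g x)
  simpa using this

/-- `D Hom(M, M)` is the dual of the regular `End(M)`-module. -/
noncomputable def dualHomSelf :
    DualHom K M M ≃ₗ[Module.End A M] DualRegular K (Module.End A M) where
  toFun φ := DualHom.toDual φ
  invFun φ := DualHom.toDual.symm φ
  map_add' _ _ := rfl
  map_smul' _ _ := rfl
  left_inv _ := rfl
  right_inv _ := rfl

variable {M} in
theorem InAdd.injective_dualHom (h : InAdd A M X) :
    Module.Injective (Module.End A M) (DualHom K M X) :=
  .of_inAdd h.dualHom (.of_inAdd ((InAdd.refl _ _).of_equiv (dualHomSelf M).symm)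
    injective_dualRegular)

/-- The module `D Hom(M, X)` over `End(M)`. -/
noncomputable abbrev FDModule.dualHom (X : FDModule K A) : FDModule K (Module.End A M) :=
  ⟨DualHom K M X⟩

variable {M} in
-- Vanishing of `Ext(M, -)` passes from `X` and `Q` to the cosyzygy `X'`. Thus every short exact
-- piece stays exact under `Hom(M, -)`, and duality reverses it.
theorem HasChain.dualHom {P : FDModule K A} {n : ℕ} (h : HasChain P n X Y)
    (hX : ExtVanish A M X) (hP : ExtVanish A M P) :
    HasChain (FDModule.dualHom M P) n (FDModule.dualHom M Y) (FDModule.dualHom M X) := by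
  induction n generalizing X with
  | zero => exact h.map fun e => dualHomCongr M e
  | succ n ih =>
    obtain ⟨Q, X', f, g, hQ, hfg, h⟩ := h
    exact (ih h (hfg.extVanish₃ hX (hP.of_inAdd_right hQ))).snoc
      (Q := FDModule.dualHom M Q) hQ.dualHom (hfg.dualHom M (hfg.exists_lift (hX 1 le_rfl)))

end DualHom

/-! ### Reflexivity with respect to `D Hom(M, -)` -/

section Good

variable {K : Type u} [Field K] {A : Type u} [Ring A] [Algebra K A] (M W : FDModule K A)
  {X Y Z : FDModule K A}

/-- The natural map `D Hom(W, X) → Hom_{End(M)}(Hom(W, M), D Hom(M, X))`. -/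
noncomputable def dualHomEval (X : FDModule K A) (ξ : DualHom K W X) :
    (W →ₗ[A] M) →ₗ[Module.End A M] DualHom K M X where
  toFun g := DualHom.toDual.symm
    { toFun := fun f => DualHom.toDual ξ (f ∘ₗ g)
      map_add' := fun f f' => by rw [LinearMap.add_comp, map_add]
      map_smul' := fun c f => by rw [LinearMap.smul_comp, map_smul, RingHom.id_apply] }
  map_add' g g' := DualHom.ext fun f => by
    change DualHom.toDual ξ (f ∘ₗ (g + g')) = _
    rw [LinearMap.comp_add, map_add]
    rfl
  map_smul' γ g := DualHom.ext fun f => rfl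

variable {M W}

@[simp]
theorem toDual_dualHomEval (ξ : DualHom K W X) (g : W →ₗ[A] M) (f : M →ₗ[A] X) :
    DualHom.toDual (dualHomEval M W X ξ g) f = DualHom.toDual ξ (f ∘ₗ g) := rfl

theorem dualHomEval_dualHomMap (h : X →ₗ[A] Y) (ξ : DualHom K W Y) :
    dualHomEval M W X (dualHomMap W h ξ) = dualHomMap M h ∘ₗ dualHomEval M W Y ξ := rfl

theorem dualHomEval_sub (ξ η : DualHom K W X) :
    dualHomEval M W X (ξ - η) = dualHomEval M W X ξ - dualHomEval M W X η := by
  refine LinearMap.ext fun g => DualHom.ext fun f => ?_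
  simp

theorem dualHomEval_injective_iff : Function.Injective (dualHomEval M W X) ↔
    ∀ ξ, dualHomEval M W X ξ = 0 → ξ = 0 := by
  refine ⟨fun h ξ hξ => h (hξ.trans (LinearMap.ext fun g => DualHom.ext fun f => ?_)),
    fun h ξ η hξη => ?_⟩
  · rfl
  · exact sub_eq_zero.mp (h _ (by rw [dualHomEval_sub, hξη, sub_self]))

/-- For `X = M` this is `D Hom(W, M) ≅ Hom_{End(M)}(Hom(W, M), D End(M))`, the adjunction for the
dual of the regular module; summands of `M^n` inherit it. -/
theorem dualHomEval_bijective_of_inAdd (h : InAdd A M X) :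
    Function.Bijective (dualHomEval M W X) := by
  obtain ⟨n, i, p, h⟩ := h.exists_sum_comp
  constructor
  · rw [dualHomEval_injective_iff]
    intro ξ hξ
    refine DualHom.ext fun f => ?_
    have : f = ∑ j, p j ∘ₗ (i j ∘ₗ f) := by
      ext x
      simpa using (LinearMap.congr_fun h (f x)).symm
    rw [this, map_sum, map_zero, LinearMap.zero_apply]
    refine Finset.sum_eq_zero fun j _ => ?_
    rw [← toDual_dualHomEval, hξ]
    simp
  · intro η
    -- Since `f = ∑ p j ∘ (i j ∘ f)`, a preimage of `η` can only be `f ↦ ∑ η (i j ∘ f) (p j)`.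
    refine ⟨DualHom.toDual.symm
      { toFun := fun f => ∑ j, DualHom.toDual (η (i j ∘ₗ f)) (p j)
        map_add' := fun f f' => by
          simp only [LinearMap.comp_add, map_add, LinearMap.add_apply, Finset.sum_add_distrib]
        map_smul' := fun c f => ?_ }, ?_⟩
    · rw [RingHom.id_apply, Finset.smul_sum]
      refine Finset.sum_congr rfl fun j _ => ?_
      have : i j ∘ₗ (c • f) = c • (i j ∘ₗ f) :=
        LinearMap.ext fun x => LinearMap.map_smul_of_tower (i j) c (f x)
      rw [this, LinearMap.map_smul_of_tower, map_smul, LinearMap.smul_apply]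
    · refine LinearMap.ext fun g => DualHom.ext fun f => ?_
      change ∑ j, DualHom.toDual (η (i j ∘ₗ (f ∘ₗ g))) (p j) = _
      have h1 : ∀ j, η (i j ∘ₗ (f ∘ₗ g)) = (show Module.End A M from i j ∘ₗ f) • η g := by
        intro j
        rw [← map_smul]
        rfl
      simp only [h1, DualHom.toDual_smul]
      rw [← map_sum]
      congr 1
      ext x
      simpa using LinearMap.congr_fun h (f x)

variable (M W X) in
/-- The natural map `D Hom(W, X) → Hom_{End(M)}(Hom(W, M), D Hom(M, X))` is an isomorphism, and the
higher extension groups `Ext^i_{End(M)}(Hom(W, M), D Hom(M, X))` vanish. -/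
structure IsGood : Prop where
  bijective : Function.Bijective (dualHomEval M W X)
  extVanish : ExtVanish (Module.End A M) (W →ₗ[A] M) (DualHom K M X)

theorem IsGood.of_inAdd (h : InAdd A M X) : IsGood M W X where
  bijective := dualHomEval_bijective_of_inAdd h
  extVanish := .of_injective _ _ _ h.injective_dualHom

theorem IsGood.of_equiv (e : X ≃ₗ[A] Y) (h : IsGood M W X) : IsGood M W Y where
  bijective := by
    have : dualHomEval M W Y = (fun η => (dualHomCongr M e.symm).toLinearMap ∘ₗ η) ∘
        dualHomEval M W X ∘ dualHomCongr W e := by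
      funext ξ
      refine LinearMap.ext fun g => DualHom.ext fun f => ?_
      change _ = DualHom.toDual ξ (e.toLinearMap ∘ₗ ((e.symm.toLinearMap ∘ₗ f) ∘ₗ g))
      rw [toDual_dualHomEval]
      congr 1
      ext x
      simp
    rw [this]
    refine Function.Bijective.comp ?_ (h.bijective.comp (dualHomCongr W e).bijective)
    refine ⟨fun η η' hη => LinearMap.ext fun g => (dualHomCongr M e.symm).injective
      (LinearMap.congr_fun hη g), fun η => ⟨(dualHomCongr M e.symm).symm.toLinearMap ∘ₗ η, ?_⟩⟩
    exact LinearMap.ext fun g => (dualHomCongr M e.symm).apply_symm_apply (η g)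
  extVanish := h.extVanish.of_equiv_right (dualHomCongr M e.symm)

/-- In `0 → D Hom(M, Z) → D Hom(M, Y) → D Hom(M, X) → 0` the middle term is injective. A map from
`Hom(W, M)` to the right term comes from `D Hom(W, X)`, hence from `D Hom(W, Y)`, so it lifts; this
removes `Ext^1` into `D Hom(M, Z)`. Bijectivity is a diagram chase comparing this sequence with the
one for `W`. -/
theorem IsGood.step {f : X →ₗ[A] Y} {g : Y →ₗ[A] Z} (h : IsShortExact f g) (hY : InAdd A M Y)
    (hM : ∀ b : M →ₗ[A] Z, ∃ c : M →ₗ[A] Y, g ∘ₗ c = b)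
    (hW : ∀ b : W →ₗ[A] Z, ∃ c : W →ₗ[A] Y, g ∘ₗ c = b) (hX : IsGood M W X) :
    IsGood M W Z where
  extVanish := by
    refine (h.dualHom M hM).extVanish₁_of_lift
      (.of_injective _ _ _ hY.injective_dualHom) hX.extVanish fun η => ?_
    obtain ⟨ξ, rfl⟩ := hX.bijective.2 η
    obtain ⟨ζ, rfl⟩ := dualHomMap_surjective W f h.injective ξ
    exact ⟨dualHomEval M W Y ζ, rfl⟩
  bijective := by
    have hYb : Function.Bijective (dualHomEval M W Y) := dualHomEval_bijective_of_inAdd hY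
    have hXi := dualHomEval_injective_iff.mp hX.bijective.1
    constructor
    · rw [dualHomEval_injective_iff]
      intro ξ hξ
      refine dualHomMap_injective W g hW ?_
      rw [map_zero]
      refine dualHomEval_injective_iff.mp hYb.1 _ ?_
      rw [dualHomEval_dualHomMap, hξ, LinearMap.comp_zero]
    · intro η
      obtain ⟨ζ, hζ⟩ := hYb.2 (dualHomMap M g ∘ₗ η)
      have : dualHomMap W f ζ = 0 := by
        refine hXi _ ?_
        rw [dualHomEval_dualHomMap, hζ, ← LinearMap.comp_assoc,
          (h.dualHom M hM).comp_eq_zero, LinearMap.zero_comp]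
      obtain ⟨ξ, rfl⟩ := exists_dualHomMap_eq W h hW this
      refine ⟨ξ, LinearMap.ext fun a => dualHomMap_injective M g hM ?_⟩
      exact LinearMap.congr_fun hζ a

theorem IsGood.of_hasChain {P : FDModule K A} {n : ℕ} (h : HasChain P n X Y) (hP : InAdd A M P)
    (hMX : ExtVanish A M X) (hMP : ExtVanish A M P) (hWX : ExtVanish A W X)
    (hWP : ExtVanish A W P) (hX : IsGood M W X) : IsGood M W Y := by
  induction n generalizing X with
  | zero =>
    obtain ⟨e⟩ := h
    exact hX.of_equiv e
  | succ n ih =>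
    obtain ⟨Q, X', f, g, hQ, hfg, h⟩ := h
    exact ih h (hfg.extVanish₃ hMX (hMP.of_inAdd_right hQ))
      (hfg.extVanish₃ hWX (hWP.of_inAdd_right hQ))
      (.step hfg (hP.trans hQ) (hfg.exists_lift (hMX 1 le_rfl)) (hfg.exists_lift (hWX 1 le_rfl)) hX)

end Good

/-! ### Cotilting modules and the classes `cogen` -/

section Cotilting

variable {K : Type u} [Field K] {A : Type u} [Ring A] [Algebra K A]

/-- There are exact sequences `0 → X → Y_0 → ⋯ → Y_k → 0` with all `Y_i` in `add Y` and
`0 → X_k → ⋯ → X_0 → Y → 0` with all `X_i` in `add X`. -/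
def IsLinked (k : ℕ) (X Y : FDModule K A) : Prop :=
  (∃ I : FDModule K A, InAdd A Y I ∧ HasChain Y k X I) ∧
    ∃ I : FDModule K A, InAdd A X I ∧ HasChain X k I Y

variable {k : ℕ} {M C X X' Y Y' : FDModule K A}

theorem IsLinked.of_equiv (e : X ≃ₗ[A] X') (e' : Y ≃ₗ[A] Y') (h : IsLinked k X Y) :
    IsLinked k X' Y' := by
  obtain ⟨⟨I, hI, h⟩, I', hI', h'⟩ := h
  exact ⟨⟨I, hI.of_equiv_left e', (h.of_equiv_left e).congr_add ((InAdd.refl A _).of_equiv e'.symm)⟩,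
    I', hI'.of_equiv_left e, (h'.of_equiv_right e').congr_add ((InAdd.refl A _).of_equiv e.symm)⟩

/-- Reversing the two sequences also interchanges their roles, so the relation survives with its
ends swapped. -/
theorem IsLinked.dualHom (h : IsLinked k X Y) (hX : ExtVanish A M X) (hY : ExtVanish A M Y) :
    IsLinked k (FDModule.dualHom M Y) (FDModule.dualHom M X) := by
  obtain ⟨⟨I, hI, h⟩, I', hI', h'⟩ := h
  exact ⟨⟨_, hI'.dualHom, h'.dualHom (hX.of_inAdd_right hI') hX⟩, _, hI.dualHom, h.dualHom hX hY⟩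

/-- Of the `k + 1` terms in `add X`, the leftmost becomes the end `I` and the other `k` are the
middle terms of the chain. -/
theorem exists_seq_to_iff :
    (∃ (Z : ℕ → FDModule K A) (d : ∀ i, Z i →ₗ[A] Z (i + 1)),
      IsExactSeq k Z d ∧ (∀ i ≤ k, InAdd A X (Z i)) ∧ Nonempty (Z (k + 1) ≃ₗ[A] Y)) ↔
    ∃ I : FDModule K A, InAdd A X I ∧ HasChain X k I Y := by
  constructor
  · rintro ⟨Z, d, h, hZ, ⟨e⟩⟩
    exact ⟨Z 0, hZ 0 (Nat.zero_le k), (h.hasChain fun i _ hi => hZ i hi).of_equiv_right e⟩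
  · rintro ⟨I, hI, h⟩
    obtain ⟨Z, d, h, ⟨e⟩, h', hZ⟩ := h.exists_isExactSeq
    refine ⟨Z, d, h, fun i hi => ?_, h'⟩
    rcases Nat.eq_zero_or_pos i with rfl | hi'
    · exact hI.of_equiv e.symm
    · exact hZ i hi' hi

theorem exists_seq_from_iff :
    (∃ (Z : ℕ → FDModule K A) (d : ∀ i, Z i →ₗ[A] Z (i + 1)),
      IsExactSeq k Z d ∧ Nonempty (Z 0 ≃ₗ[A] X) ∧ ∀ i ≤ k, InAdd A Y (Z (i + 1))) ↔
    ∃ I : FDModule K A, InAdd A Y I ∧ HasChain Y k X I := by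
  constructor
  · rintro ⟨Z, d, h, ⟨e⟩, hZ⟩
    refine ⟨Z (k + 1), hZ k le_rfl, (h.hasChain fun i hi hi' => ?_).of_equiv_left e⟩
    obtain ⟨i, rfl⟩ : ∃ j, i = j + 1 := ⟨i - 1, by omega⟩
    exact hZ i (by omega)
  · rintro ⟨I, hI, h⟩
    obtain ⟨Z, d, h, h', ⟨e⟩, hZ⟩ := h.exists_isExactSeq
    refine ⟨Z, d, h, h', fun i hi => ?_⟩
    rcases Nat.lt_or_eq_of_le hi with hi' | rfl
    · exact hZ (i + 1) (by omega) (by omega)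
    · exact hI.of_equiv e.symm

theorem isRestrictedCotilting_iff [Module.Finite K A] : IsRestrictedCotilting k Y X ↔
    Module.Injective A Y ∧ ExtVanish A X X ∧ IsLinked k X Y := by
  unfold IsRestrictedCotilting IsLinked
  rw [exists_seq_from_iff, exists_seq_to_iff]
  exact ⟨fun ⟨h₁, h₂, h₃, h₄⟩ => ⟨h₁, h₃, h₂, h₄⟩, fun ⟨h₁, h₂, h₃, h₄⟩ => ⟨h₁, h₃, h₂, h₄⟩⟩

theorem isCotilting_iff [Module.Finite K A] : IsCotilting k C ↔
    ExtVanish A C C ∧ IsLinked k C (FDModule.dualRegular K A) := by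
  unfold IsCotilting IsLinked
  rw [exists_seq_to_iff]
  refine and_congr Iff.rfl (and_congr ⟨exists_chain_of_hasInjectiveDimensionLE, ?_⟩ Iff.rfl)
  rintro ⟨I, hI, h⟩
  exact h.hasInjectiveDimensionLE injective_dualRegular (.of_inAdd hI injective_dualRegular)

/-- The last map of the chain works: its kernel is `X` or a cosyzygy, with no `Ext^1` from `M`. A
middle term must exist, hence the length `n + 1`. -/
theorem HasChain.exists_lift {n : ℕ} {P : FDModule K A} (h : HasChain P (n + 1) X Y)
    (hX : ExtVanish A M X) (hP : ExtVanish A M P) :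
    ∃ (Q : FDModule K A) (q : Q →ₗ[A] Y), InAdd A P Q ∧
      ∀ b : M →ₗ[A] Y, ∃ c : M →ₗ[A] Q, q ∘ₗ c = b := by
  induction n generalizing X with
  | zero =>
    obtain ⟨Q, X', f, g, hQ, hfg, ⟨e⟩⟩ := h
    exact ⟨Q, _, hQ, (hfg.of_equiv_right e).exists_lift (hX 1 le_rfl)⟩
  | succ n ih =>
    obtain ⟨Q, X', f, g, hQ, hfg, h⟩ := h
    exact ih h (hfg.extVanish₃ hX (hP.of_inAdd_right hQ))

theorem mem_cogen_of_inAdd (h : InAdd A M X) (n : ℕ) : X ∈ cogen n M := by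
  induction n generalizing X with
  | zero => exact mem_cogen_zero (f := LinearMap.id) Function.injective_id h fun b => ⟨b, rfl⟩
  | succ n ih =>
    refine mem_cogen_succ (X' := ⟨PUnit⟩) (f := LinearMap.id) (g := 0) ?_ h (fun b => ⟨b, rfl⟩)
      (ih .zero)
    exact ⟨Function.injective_id, fun x => ⟨fun _ => ⟨x, rfl⟩, fun _ => rfl⟩, fun x => ⟨0, rfl⟩⟩

theorem exists_left_approximation (M X : FDModule K A) :
    ∃ (n : ℕ) (f : X →ₗ[A] (Fin n → M)), ∀ b : X →ₗ[A] M, ∃ c : (Fin n → M) →ₗ[A] M,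
      c ∘ₗ f = b := by
  let β := Module.finBasis K (X →ₗ[A] M)
  refine ⟨_, LinearMap.pi fun j => β j, fun b => ⟨∑ j, β.repr b j • LinearMap.proj j, ?_⟩⟩
  refine LinearMap.ext fun x => ?_
  have := LinearMap.congr_fun (β.sum_repr b) x
  simp only [LinearMap.sum_apply, LinearMap.smul_apply] at this
  simp only [LinearMap.comp_apply, LinearMap.sum_apply, LinearMap.smul_apply,
    LinearMap.proj_apply, LinearMap.pi_apply, this]

theorem InAdd.exists_extend (hC : InAdd A M C) {Q : Type u} [AddCommGroup Q] [Module A Q]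
    {f : X →ₗ[A] Q} (hf : ∀ b : X →ₗ[A] M, ∃ c : Q →ₗ[A] M, c ∘ₗ f = b) (b : X →ₗ[A] C) :
    ∃ c : Q →ₗ[A] C, c ∘ₗ f = b := by
  obtain ⟨n, i, p, h⟩ := hC.exists_sum_comp
  choose c hc using fun j => hf (i j ∘ₗ b)
  refine ⟨∑ j, p j ∘ₗ c j, LinearMap.ext fun x => ?_⟩
  have h1 : ∀ j, c j (f x) = i j (b x) := fun j => LinearMap.congr_fun (hc j) x
  have := LinearMap.congr_fun h (b x)
  simp only [LinearMap.sum_apply, LinearMap.comp_apply, LinearMap.id_apply] at this ⊢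
  simp only [h1, this]

variable [Module.Finite K A]

/-- `C` cogenerates `⊥C`: embed `X` into copies of `D A` and lift each coordinate through `C_0 → D
A`. An element killed by all maps to `C` is killed by these lifts, so it is zero. -/
theorem IsCotilting.exists_ne_zero (hk : 1 ≤ k) (hC : IsCotilting k C) (hX : ExtVanish A X C)
    {x : X} (hx : x ≠ 0) : ∃ b : X →ₗ[A] C, b x ≠ 0 := by
  obtain ⟨_, _, I, hI, h⟩ := isCotilting_iff.mp hC
  obtain ⟨k, rfl⟩ : ∃ j, k = j + 1 := ⟨k - 1, by omega⟩
  obtain ⟨Q, q, hQ, hq⟩ := h.exists_lift (hX.of_inAdd_right hI) hX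
  obtain ⟨n, f, hf⟩ := exists_injective_dualRegular X
  obtain ⟨m, i, p, hip⟩ := hQ.exists_sum_comp
  by_contra! hb
  refine hx (hf ?_)
  rw [map_zero]
  funext j
  obtain ⟨c, hc⟩ := hq (LinearMap.proj j ∘ₗ f)
  have h1 : c x = 0 := by
    have := LinearMap.congr_fun hip (c x)
    rw [LinearMap.id_apply] at this
    rw [← this, LinearMap.sum_apply]
    refine Finset.sum_eq_zero fun l _ => ?_
    have h2 := hb (i l ∘ₗ c)
    rw [LinearMap.comp_apply] at h2
    rw [LinearMap.comp_apply, h2, map_zero]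
  have := LinearMap.congr_fun hc x
  rw [LinearMap.comp_apply, h1, map_zero] at this
  exact this.symm

theorem IsCotilting.exists_injective_left_approximation (hk : 1 ≤ k) (hC : IsCotilting k C)
    (hMC : InAdd A M C) (hX : ExtVanish A X C) :
    ∃ (n : ℕ) (f : X →ₗ[A] (Fin n → M)), Function.Injective f ∧
      ∀ b : X →ₗ[A] M, ∃ c : (Fin n → M) →ₗ[A] M, c ∘ₗ f = b := by
  obtain ⟨m, f, hf⟩ := exists_left_approximation M X
  refine ⟨m, f, ?_, hf⟩
  rw [injective_iff_map_eq_zero]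
  intro x hx
  by_contra hx0
  obtain ⟨b, hb⟩ := hC.exists_ne_zero hk hX hx0
  obtain ⟨c, rfl⟩ := hMC.exists_extend hf b
  exact hb (by rw [LinearMap.comp_apply, hx, map_zero])

/-- A left `add M`-approximation of `X` is injective because `C ∈ add M` cogenerates `X`. Maps `X →
C` extend along it, so the cokernel is again in `⊥C` and the construction repeats. -/
theorem IsCotilting.mem_cogen (hk : 1 ≤ k) (hC : IsCotilting k C) (hMC : InAdd A M C)
    (hM : ExtVanish A M C) (hX : ExtVanish A X C) (n : ℕ) : X ∈ cogen n M := by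
  induction n generalizing X with
  | zero =>
    obtain ⟨m, f, hfi, hf⟩ := hC.exists_injective_left_approximation hk hMC hX
    exact mem_cogen_zero (Q := ⟨Fin m → M⟩) hfi (.pi A M m) hf
  | succ n ih =>
    obtain ⟨m, f, hfi, hf⟩ := hC.exists_injective_left_approximation hk hMC hX
    have hse := isShortExact_mkQ f hfi
    refine mem_cogen_succ (Q := ⟨Fin m → M⟩) (X' := ⟨(Fin m → M) ⧸ LinearMap.range f⟩) hse
      (.pi A M m) hf (ih ?_)
    exact hse.extVanish₃_of_extend hX (hM.of_inAdd_left (.pi A M m)) (hMC.exists_extend hf)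

/-- For the inclusion in `⊥C`, a module in `cogen^{k-1}(M)` starts a left exact sequence with `k`
terms from `add M`, all in `⊥C`. Shifting by `k` degrees passes the injective dimension of `C`. -/
theorem IsCotilting.cogen_eq_leftPerp (hk : 1 ≤ k) (hC : IsCotilting k C) (hMC : InAdd A M C)
    (hM : ExtVanish A M C) : cogen (k - 1) M = leftPerp C := by
  refine Set.Subset.antisymm ?_ fun X hX => hC.mem_cogen hk hMC hM hX _
  rintro X ⟨Z, d, ⟨e⟩, hZ, hd, -⟩
  have hdim := hC.2.1
  have : ExtVanish A (Z 0) C := fun i hi =>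
    hd.subsingleton_ext (W := C.toModuleCat) 0
      (fun j hj l hl => (hM.of_inAdd_left (hZ j hj)) l hl)
      (fun Y j hj => HasInjectiveDimensionLT.subsingleton _ (k + 1) j (by omega) Y) i (by omega)
  exact this.of_equiv_left e

end Cotilting

/-! ### The conditions on `cogen` as vanishing of extensions -/

namespace AlgTriple

variable {K : Type u} [Field K] {k : ℕ} {t : AlgTriple K}

theorem isCogenTriple_iff (hk : 1 ≤ k) : t.IsCogenTriple k ↔
    IsCotilting k t.snd ∧ InAdd t.alg t.fst t.snd ∧ ExtVanish t.alg t.fst t.snd := by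
  constructor
  · rintro ⟨h₁, h₂, h₃, h₄⟩
    refine ⟨h₁, h₂, ?_⟩
    have : t.fst ∈ leftPerp t.snd := by
      rw [← h₄, ← h₃]
      exact mem_cogen_of_inAdd (.refl _ _) _
    exact this
  · rintro ⟨h₁, h₂, h₃⟩
    have := h₁.cogen_eq_leftPerp hk (.refl _ _) h₁.1
    exact ⟨h₁, h₂, (h₁.cogen_eq_leftPerp hk h₂ h₃).trans this.symm, this⟩

theorem isGeneratorTriple_iff (hk : 1 ≤ k) : t.IsGeneratorTriple k ↔
    IsCotilting k t.snd ∧ InAdd t.alg t.fst t.alg ∧ ExtVanish t.alg t.fst t.snd := by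
  refine and_congr_right fun h => and_congr_right fun _ => ?_
  rw [h.cogen_eq_leftPerp hk (.refl _ _) h.1]
  rfl

end AlgTriple

/-! ### Bicommutants and reflexivity -/

section Reflexive

variable {K : Type u} [Field K] {A : Type u} [Ring A] [Algebra K A] (M : FDModule K A)
  {W X Y : FDModule K A}

/-- The module `M` over its endomorphism ring. -/
abbrev FDModule.overEnd : FDModule K (Module.End A M) := ⟨M⟩

variable {M} in
theorem InAdd.homInto (h : InAdd A X Y) :
    InAdd (Module.End A M) (X →ₗ[A] M) (Y →ₗ[A] M) := by
  obtain ⟨n, i, p, h⟩ := h.exists_sum_comp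
  refine .of_sum_comp
    (fun j => { toFun := fun f => f ∘ₗ p j, map_add' := fun _ _ => rfl, map_smul' := fun _ _ => rfl })
    (fun j => { toFun := fun f => f ∘ₗ i j, map_add' := fun _ _ => rfl, map_smul' := fun _ _ => rfl })
    ?_
  refine LinearMap.ext fun g => LinearMap.ext fun x => ?_
  have := LinearMap.congr_fun h x
  simp only [LinearMap.sum_apply, LinearMap.comp_apply, LinearMap.id_apply, LinearMap.coe_mk,
    AddHom.coe_mk] at this ⊢
  rw [← map_sum, this]

/-- A map commuting with every `End(M)`-endomorphism of `M` commutes with the action of each `a ∈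
A`, so it already lies in `End(M)`. -/
theorem isFaithfullyBalanced_overEnd : IsFaithfullyBalanced M.overEnd := by
  constructor
  · intro γ γ' h
    exact LinearMap.ext fun x => LinearMap.congr_fun h x
  · intro φ
    refine ⟨{ toFun := φ, map_add' := map_add φ, map_smul' := fun a x => ?_ }, rfl⟩
    let a' : Module.End (Module.End A M) M :=
      { toFun := fun y => a • y
        map_add' := smul_add a
        map_smul' := fun γ y => (LinearMap.map_smul γ a y).symm }
    exact φ.map_smul a' x

theorem ExtVanish.regular_left (A X : Type u) [Ring A] [AddCommGroup X] [Module A X] :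
    ExtVanish A A X := by
  intro i hi
  obtain ⟨i, rfl⟩ : ∃ j, i = j + 1 := ⟨i - 1, by omega⟩
  have : Projective (ModuleCat.of A A) := (IsProjective.iff_projective A).mp inferInstance
  exact Ext.subsingleton_of_projective _ _ i

/-- Evaluation `x ↦ (g ↦ g x)` from `W` to `Hom_{End(M)}(Hom(W, M), M)`. -/
def evalHom (x : W) : (W →ₗ[A] M) →ₗ[Module.End A M] M where
  toFun g := g x
  map_add' _ _ := rfl
  map_smul' _ _ := rfl

/-- The natural map `D X → Hom_{End(M)}(M, D Hom(M, X))`. -/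
noncomputable def dualEval (X : FDModule K A) :
    Module.Dual K X →ₗ[K] M →ₗ[Module.End A M] DualHom K M X where
  toFun ζ :=
    { toFun := fun m => DualHom.toDual.symm
        { toFun := fun f => ζ (f m)
          map_add' := fun f f' => map_add ζ (f m) (f' m)
          map_smul' := fun c f => map_smul ζ c (f m) }
      map_add' := fun m m' => DualHom.ext fun f => by
        change ζ (f (m + m')) = ζ (f m) + ζ (f m')
        rw [map_add, map_add]
      map_smul' := fun γ m => rfl }
  map_add' _ _ := rfl
  map_smul' _ _ := rfl

@[simp]
theorem toDual_dualEval (ζ : Module.Dual K X) (m : M) (f : M →ₗ[A] X) :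
    DualHom.toDual (dualEval M X ζ m) f = ζ (f m) := rfl

variable {M} in
/-- If `D X → Hom_{End(M)}(M, D Hom(M, X))` is an isomorphism, then so is its dual. -/
noncomputable def bidualEquiv (h : Function.Bijective (dualEval M X)) :
    X ≃ₗ[K] Module.Dual K (M →ₗ[Module.End A M] DualHom K M X) :=
  (Module.evalEquiv K X).trans (LinearEquiv.ofBijective (dualEval M X) h).symm.dualMap

variable {M} in
theorem bidualEquiv_apply_dualEval (h : Function.Bijective (dualEval M X)) (x : X)
    (ζ : Module.Dual K X) : bidualEquiv h x (dualEval M X ζ) = ζ x := by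
  have : (LinearEquiv.ofBijective (dualEval M X) h).symm (dualEval M X ζ) = ζ :=
    (LinearEquiv.ofBijective (dualEval M X) h).symm_apply_apply ζ
  change ((LinearEquiv.ofBijective (dualEval M X) h).symm (dualEval M X ζ)) x = ζ x
  rw [this]

variable [Module.Finite K A]

/-- Evaluation at `1`. -/
def homRegularEquiv : (FDModule.regular K A →ₗ[A] M) ≃ₗ[Module.End A M] M where
  toFun g := g (1 : A)
  invFun m := LinearMap.toSpanSingleton A M m
  map_add' _ _ := rfl
  map_smul' _ _ := rfl
  left_inv g := LinearMap.ext fun a => by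
    rw [LinearMap.toSpanSingleton_apply, ← map_smul, smul_eq_mul, mul_one]
  right_inv m := one_smul A m

/-- The natural map `M → D Hom(M, D A)`. -/
noncomputable def toDualHomDualRegular :
    M →ₗ[Module.End A M] DualHom K M (FDModule.dualRegular K A) where
  toFun m := DualHom.toDual.symm
    { toFun := fun f => DualRegular.toDual (f m) 1
      map_add' := fun _ _ => rfl
      map_smul' := fun _ _ => rfl }
  map_add' m m' := DualHom.ext fun f => by
    change DualRegular.toDual (f (m + m')) 1 = _
    rw [map_add]
    rfl
  map_smul' γ m := rfl

theorem toDual_toDualHomDualRegular (m : M) (f : M →ₗ[A] FDModule.dualRegular K A) :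
    DualHom.toDual (toDualHomDualRegular M m) f = DualRegular.toDual (f m) 1 := rfl

/-- Since `Hom(M, D A) ≅ D M`, this is the isomorphism of `M` with its bidual. -/
theorem toDualHomDualRegular_bijective : Function.Bijective (toDualHomDualRegular M) := by
  constructor
  · refine (injective_iff_map_eq_zero _).mpr fun m hm => ?_
    refine (Module.forall_dual_apply_eq_zero_iff K m).mp fun ξ => ?_
    have : ξ ((1 : A) • m) = 0 :=
      congrArg (fun φ => DualHom.toDual φ (dualRegularLift (A := A) ξ)) hm
    rwa [one_smul] at this
  · intro φ
    let ψ : Module.Dual K (Module.Dual K M) :=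
      { toFun := fun ξ => DualHom.toDual φ (dualRegularLift ξ)
        map_add' := fun ξ ξ' =>
          map_add (DualHom.toDual φ) (dualRegularLift ξ) (dualRegularLift ξ')
        map_smul' := fun c ξ => map_smul (DualHom.toDual φ) c (dualRegularLift ξ) }
    refine ⟨(Module.evalEquiv K M).symm ψ, DualHom.ext fun f => ?_⟩
    obtain ⟨ξ, rfl⟩ := exists_dualRegularLift_eq f
    rw [toDual_toDualHomDualRegular, toDual_dualRegularLift, one_smul]
    have : Module.evalEquiv K M ((Module.evalEquiv K M).symm ψ) ξ = ψ ξ := by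
      rw [LinearEquiv.apply_symm_apply]
    exact this

/-- The isomorphism `M ≃ D Hom(M, D A)`. -/
noncomputable def dualHomDualRegularEquiv :
    M ≃ₗ[Module.End A M] DualHom K M (FDModule.dualRegular K A) :=
  .ofBijective _ (toDualHomDualRegular_bijective M)

variable {M}

theorem IsGood.evalHom_bijective (h : IsGood M W (FDModule.dualRegular K A)) :
    Function.Bijective (evalHom M (W := W)) := by
  have key : ∀ x : W, (toDualHomDualRegular M) ∘ₗ evalHom M x =
      dualHomEval M W _ (toDualHomDualRegular W x) := fun x => rfl
  constructor
  · intro x y hxy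
    refine (toDualHomDualRegular_bijective W).1 (h.bijective.1 ?_)
    rw [← key, ← key, hxy]
  · intro φ
    obtain ⟨ξ, hξ⟩ := h.bijective.2 (toDualHomDualRegular M ∘ₗ φ)
    obtain ⟨x, rfl⟩ := (toDualHomDualRegular_bijective W).2 ξ
    refine ⟨x, LinearMap.ext fun g => (toDualHomDualRegular_bijective M).1 ?_⟩
    exact LinearMap.congr_fun hξ g

/-- With `W = A`, the identification `Hom(A, M) ≅ M` turns evaluation at `a` into the action of `a`
on `M`. -/
theorem IsGood.isFaithfullyBalanced
    (h : IsGood M (FDModule.regular K A) (FDModule.dualRegular K A)) :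
    IsFaithfullyBalanced M := by
  have key : ∀ a : A, (show M →ₗ[Module.End A M] M from
        Module.toModuleEnd (Module.End A M) (S := A) M a) ∘ₗ (homRegularEquiv M).toLinearMap =
      evalHom M (W := FDModule.regular K A) a := by
    intro a
    refine LinearMap.ext fun g => ?_
    change a • g (1 : A) = g a
    rw [← map_smul, smul_eq_mul, mul_one]
  constructor
  · intro a b hab
    refine h.evalHom_bijective.1 ?_
    rw [← key, ← key, hab]
  · intro φ
    obtain ⟨a, ha⟩ := h.evalHom_bijective.2 (φ ∘ₗ (homRegularEquiv M).toLinearMap)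
    refine ⟨a, LinearMap.ext fun m => ?_⟩
    have := LinearMap.congr_fun ((key a).trans ha) ((homRegularEquiv M).symm m)
    simpa only [LinearMap.comp_apply, LinearEquiv.coe_coe, LinearEquiv.apply_symm_apply] using this

/-- `dualEval` is `dualHomEval` for `W = A`, read through `Hom(A, M) ≅ M` and `D Hom(A, X) ≅ D X`.
-/
theorem dualEval_bijective
    (h : Function.Bijective (dualHomEval M (FDModule.regular K A) X)) :
    Function.Bijective (dualEval M X) := by
  let e : Module.Dual K X → DualHom K (FDModule.regular K A) X := fun ζ => DualHom.toDual.symm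
    { toFun := fun f => ζ (f (1 : A))
      map_add' := fun f f' => map_add ζ (f (1 : A)) (f' (1 : A))
      map_smul' := fun c f => map_smul ζ c (f (1 : A)) }
  have he : Function.Injective e := by
    intro ζ ζ' hζ
    refine LinearMap.ext fun x => ?_
    have := congrArg (fun φ => DualHom.toDual φ (LinearMap.toSpanSingleton A X x)) hζ
    change ζ ((1 : A) • x) = ζ' ((1 : A) • x) at this
    rwa [one_smul] at this
  have key : ∀ ζ, dualEval M X ζ ∘ₗ (homRegularEquiv M).toLinearMap =
      dualHomEval M (FDModule.regular K A) X (e ζ) := fun ζ => rfl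
  constructor
  · intro ζ ζ' hζ
    refine he (h.1 ?_)
    rw [← key, ← key, hζ]
  · intro η
    obtain ⟨ξ, hξ⟩ := h.2 (η ∘ₗ (homRegularEquiv M).toLinearMap)
    refine ⟨{ toFun := fun x => DualHom.toDual ξ (LinearMap.toSpanSingleton A X x)
              map_add' := fun x y => ?_
              map_smul' := fun c x => ?_ }, LinearMap.ext fun m => DualHom.ext fun f => ?_⟩
    · rw [LinearMap.toSpanSingleton_add, map_add]
    · rw [RingHom.id_apply, ← map_smul]
      congr 1
      ext
      simp
    · have := congrArg (fun φ => DualHom.toDual φ f)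
        (LinearMap.congr_fun hξ ((homRegularEquiv M).symm m))
      simp only [LinearMap.comp_apply, LinearEquiv.coe_coe, LinearEquiv.apply_symm_apply] at this
      rw [← this, toDual_dualEval, toDual_dualHomEval]
      change DualHom.toDual ξ _ = _
      congr 1
      ext
      change (1 : A) • f m = f ((1 : A) • m)
      rw [one_smul, one_smul]

end Reflexive

/-! ### The assignments preserve the three conditions -/

section CotiltingTriples

variable {K : Type u} [Field K] {k : ℕ} {A : Type u} [Ring A] [Algebra K A] [Module.Finite K A]
  {M C W : FDModule K A}

/-- Start at `C_k ∈ add M` and move along `0 → C_k → ⋯ → C_0 → D A → 0`. -/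
theorem IsCotilting.isGood (hC : IsCotilting k C) (hMC : InAdd A M C) (hM : ExtVanish A M C)
    (hW : ExtVanish A W C) : IsGood M W (FDModule.dualRegular K A) := by
  obtain ⟨_, _, I, hI, h⟩ := isCotilting_iff.mp hC
  exact .of_hasChain h hMC (hM.of_inAdd_right hI) hM (hW.of_inAdd_right hI) hW
    (.of_inAdd (hMC.trans hI))

/-- The functor `D Hom(C, -)` turns the link `(C, D A)` into `(C, D End(C))`. -/
theorem IsCotilting.overEnd (hC : IsCotilting k C) : IsCotilting k C.overEnd := by
  obtain ⟨h₁, h₂⟩ := isCotilting_iff.mp hC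
  have hg := hC.isGood (.refl _ _) h₁ (W := FDModule.regular K A) (.regular_left A C)
  refine isCotilting_iff.mpr ⟨?_, ?_⟩
  · exact (hg.extVanish.of_equiv_left (homRegularEquiv C)).of_equiv_right
      (dualHomDualRegularEquiv C).symm
  · exact (h₂.dualHom h₁ (.of_injective _ _ _ injective_dualRegular)).of_equiv
      (dualHomDualRegularEquiv C).symm (dualHomSelf C)

theorem IsCotilting.extVanish_homInto (hC : IsCotilting k C) (hW : ExtVanish A W C) :
    ExtVanish (Module.End A C) (W →ₗ[A] C) C :=
  (hC.isGood (.refl _ _) hC.1 hW).extVanish.of_equiv_right (dualHomDualRegularEquiv C).symm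

end CotiltingTriples

namespace AlgTriple

variable {K : Type u} [Field K] {k : ℕ} {t : AlgTriple K}

theorem IsCogenTriple.isGood (hk : 1 ≤ k) (h : t.IsCogenTriple k) :
    IsGood t.fst (FDModule.regular K t.alg) (FDModule.dualRegular K t.alg) := by
  obtain ⟨h₁, h₂, h₃⟩ := (isCogenTriple_iff hk).mp h
  exact h₁.isGood h₂ h₃ (.regular_left _ _)

theorem IsCogenTriple.dualAS (hk : 1 ≤ k) (h : t.IsCogenTriple k) :
    t.dualAS.IsRestrictedTriple k := by
  have hg := h.isGood hk
  obtain ⟨h₁, h₂, h₃⟩ := (isCogenTriple_iff hk).mp h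
  have hJ : InAdd (Module.End t.alg t.fst) (DualRegular K (Module.End t.alg t.fst))
      (DualHom K t.fst t.snd) := h₂.dualHom.of_equiv_left (dualHomSelf t.fst)
  have hN : ExtVanish (Module.End t.alg t.fst) t.fst t.fst :=
    (hg.extVanish.of_equiv_left (homRegularEquiv t.fst)).of_equiv_right
      (dualHomDualRegularEquiv t.fst).symm
  have hJ' : Module.Injective (Module.End t.alg t.fst) (DualHom K t.fst t.snd) :=
    .of_inAdd hJ injective_dualRegular
  refine ⟨hJ, isFaithfullyBalanced_overEnd t.fst, isRestrictedCotilting_iff.mpr ⟨hJ', hN, ?_⟩⟩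
  exact ((isCotilting_iff.mp h₁).2.dualHom h₃
    (.of_injective _ _ _ injective_dualRegular)).of_equiv (X' := t.fst.overEnd)
    (Y' := FDModule.dualHom t.fst t.snd) (dualHomDualRegularEquiv t.fst).symm
    (LinearEquiv.refl _ _)

theorem IsRestrictedTriple.isGood (h : t.IsRestrictedTriple k) :
    IsGood t.fst (FDModule.regular K t.alg) t.snd := by
  obtain ⟨-, -, h⟩ := h
  obtain ⟨-, h₂, -, I, hI, h⟩ := isRestrictedCotilting_iff.mp h
  exact .of_hasChain h (.refl _ _) (h₂.of_inAdd_right hI) h₂ (.regular_left _ _)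
    (.regular_left _ _) (.of_inAdd hI)

theorem IsRestrictedTriple.dualAS (hk : 1 ≤ k) (h : t.IsRestrictedTriple k) :
    t.dualAS.IsCogenTriple k := by
  have hg := h.isGood
  obtain ⟨hJ, -, h⟩ := h
  obtain ⟨h₁, h₂, h₃⟩ := isRestrictedCotilting_iff.mp h
  -- `J ∈ add D Γ` gives `D Hom(N, J) ∈ add D Hom(N, D Γ) = add N`. So self-orthogonality of the new
  -- cotilting module follows from its orthogonality to `N`.
  have hC : InAdd (Module.End t.alg t.fst) t.fst (DualHom K t.fst t.snd) :=
    (hJ.dualHom (X := FDModule.dualRegular K t.alg)).of_equiv_left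
      (dualHomDualRegularEquiv t.fst).symm
  have hM : ExtVanish (Module.End t.alg t.fst) t.fst (DualHom K t.fst t.snd) :=
    hg.extVanish.of_equiv_left (homRegularEquiv t.fst)
  have hCC : ExtVanish (Module.End t.alg t.fst) (DualHom K t.fst t.snd)
      (DualHom K t.fst t.snd) := hM.of_inAdd_left hC
  refine (isCogenTriple_iff hk).mpr ⟨isCotilting_iff.mpr ⟨hCC, ?_⟩, hC, hM⟩
  exact (h₃.dualHom h₂ (.of_injective _ _ _ h₁)).of_equiv (LinearEquiv.refl _ _)
    (dualHomSelf t.fst)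

theorem IsCogenTriple.swap_AS_swap (hk : 1 ≤ k) (h : t.IsCogenTriple k) :
    t.swap.AS.swap.IsGeneratorTriple k := by
  obtain ⟨h₁, h₂, h₃⟩ := (isCogenTriple_iff hk).mp h
  exact (isGeneratorTriple_iff hk).mpr ⟨h₁.overEnd, h₂.homInto, h₁.extVanish_homInto h₃⟩

theorem IsGeneratorTriple.swap_AS_swap (hk : 1 ≤ k) (h : t.IsGeneratorTriple k) :
    t.swap.AS.swap.IsCogenTriple k := by
  obtain ⟨h₁, h₂, h₃⟩ := (isGeneratorTriple_iff hk).mp h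
  have hC : InAdd (Module.End t.alg t.snd) (t.fst →ₗ[t.alg] t.snd) t.snd :=
    (h₂.homInto (Y := FDModule.regular K t.alg)).of_equiv (homRegularEquiv t.snd)
  exact (isCogenTriple_iff hk).mpr ⟨h₁.overEnd, hC, h₁.extVanish_homInto h₃⟩

end AlgTriple

/-! ### The assignments are mutually inverse -/

/-- Membership in `add M` is invariant under semilinear isomorphisms. -/
theorem InAdd.of_semilinear {A B : Type u} [Ring A] [Ring B] (σ : A ≃+* B) {M X M' X' : Type u}
    [AddCommGroup M] [Module A M] [AddCommGroup X] [Module A X]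
    [AddCommGroup M'] [Module B M'] [AddCommGroup X'] [Module B X']
    (e : M ≃+ M') (he : ∀ a x, e (a • x) = σ a • e x)
    (e' : X ≃+ X') (he' : ∀ a x, e' (a • x) = σ a • e' x) (h : InAdd A M X) : InAdd B M' X' := by
  obtain ⟨n, i, p, h⟩ := h.exists_sum_comp
  have hs : ∀ b x, e.symm (b • x) = σ.symm b • e.symm x := fun b x => e.injective (by
    rw [he, e.apply_symm_apply, e.apply_symm_apply, σ.apply_symm_apply])
  have hs' : ∀ b x, e'.symm (b • x) = σ.symm b • e'.symm x := fun b x => e'.injective (by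
    rw [he', e'.apply_symm_apply, e'.apply_symm_apply, σ.apply_symm_apply])
  refine .of_sum_comp
    (fun j => { toFun := fun x => e (i j (e'.symm x))
                map_add' := fun x y => by simp only [map_add]
                map_smul' := fun b x => by
                  rw [hs', map_smul, he, σ.apply_symm_apply, RingHom.id_apply] })
    (fun j => { toFun := fun x => e' (p j (e.symm x))
                map_add' := fun x y => by simp only [map_add]
                map_smul' := fun b x => by
                  rw [hs, map_smul, he', σ.apply_symm_apply, RingHom.id_apply] }) ?_
  refine LinearMap.ext fun x => ?_
  have := LinearMap.congr_fun h (e'.symm x)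
  simp only [LinearMap.sum_apply, LinearMap.comp_apply, LinearMap.id_apply, LinearMap.coe_mk,
    AddHom.coe_mk, e.symm_apply_apply] at this ⊢
  rw [← map_sum, this, e'.apply_symm_apply]

section OfAlgEquiv

variable {K : Type u} [Field K] {A B : Type u} [Ring A] [Algebra K A] [Ring B] [Algebra K B]

theorem MoritaEquivalence.ofAlgEquiv_inAdd_iff (σ : A ≃ₐ[K] B) {M M' : Type u}
    [AddCommGroup M] [Module A M] [AddCommGroup M'] [Module B M']
    (e : M ≃+ M') (he : ∀ a x, e (a • x) = σ a • e x) (X : ModuleCat.{u} A) :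
    InAdd A M X ↔ InAdd B M' ((MoritaEquivalence.ofAlgEquiv σ).eqv.functor.obj X) := by
  let e' : X ≃+ (MoritaEquivalence.ofAlgEquiv σ).eqv.functor.obj X := AddEquiv.refl X
  have he' : ∀ (a : A) (x : X), e' (a • x) = σ a • e' x := fun a x => by
    change a • x = σ.symm (σ a) • x
    rw [σ.symm_apply_apply]
  refine ⟨InAdd.of_semilinear σ.toRingEquiv e he e' he', InAdd.of_semilinear σ.toRingEquiv.symm
    e.symm (fun b x => e.injective ?_) e'.symm (fun b x => e'.injective ?_)⟩
  · rw [he, e.apply_symm_apply, e.apply_symm_apply]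
    exact congrArg (· • x) (σ.apply_symm_apply b).symm
  · rw [he', e'.apply_symm_apply, e'.apply_symm_apply]
    exact congrArg (· • x) (σ.apply_symm_apply b).symm

end OfAlgEquiv

namespace AlgTriple

variable {K : Type u} [Field K] {k : ℕ} {t : AlgTriple K}

theorem Equivalent.of_semilinear {s t : AlgTriple K} (σ : s.alg ≃ₐ[K] t.alg)
    (e₁ : s.fst ≃+ t.fst) (h₁ : ∀ (a : s.alg) x, e₁ (a • x) = σ a • e₁ x)
    (e₂ : s.snd ≃+ t.snd) (h₂ : ∀ (a : s.alg) x, e₂ (a • x) = σ a • e₂ x) : Equivalent s t :=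
  ⟨.ofAlgEquiv σ, MoritaEquivalence.ofAlgEquiv_inAdd_iff σ e₁ h₁,
    MoritaEquivalence.ofAlgEquiv_inAdd_iff σ e₂ h₂⟩

/-- For a faithfully balanced `A`-module `M`, the algebra `A` is the bicommutant of `M`. -/
noncomputable def bicommutantEquiv {A : Type u} [Ring A] [Algebra K A] {M : FDModule K A}
    (h : IsFaithfullyBalanced M) : A ≃ₐ[K] Module.End (Module.End A M) M :=
  AlgEquiv.ofBijective (Algebra.lsmul K (Module.End A M) M) h

theorem bidualEquiv_smul {A : Type u} [Ring A] [Algebra K A] {M X : FDModule K A}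
    (h : Function.Bijective (dualEval M X)) (hM : IsFaithfullyBalanced M) (a : A) (x : X)
    (η : M →ₗ[Module.End A M] DualHom K M X) :
    bidualEquiv h (a • x) η = bidualEquiv h x (η ∘ₗ bicommutantEquiv hM a) := by
  obtain ⟨ζ, rfl⟩ := h.2 η
  have : dualEval M X ζ ∘ₗ bicommutantEquiv hM a = dualEval M X (ζ ∘ₗ Algebra.lsmul K K X a) := by
    refine LinearMap.ext fun m => DualHom.ext fun f => ?_
    change ζ (f (a • m)) = ζ (a • f m)
    rw [map_smul]
  rw [this, bidualEquiv_apply_dualEval, bidualEquiv_apply_dualEval]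
  rfl

/-- The algebra returns as a bicommutant, and the last module returns because `D Hom_{End(M)}(M, D
Hom(M, X)) ≅ D D X ≅ X`. -/
theorem dualAS_dualAS (h : IsFaithfullyBalanced t.fst)
    (h' : Function.Bijective (dualEval t.fst t.snd)) : Equivalent t t.dualAS.dualAS :=
  .of_semilinear (s := t) (t := t.dualAS.dualAS) (bicommutantEquiv h) (AddEquiv.refl t.fst)
    (fun _ _ => rfl)
    ((bidualEquiv h').toAddEquiv.trans
      (DualHom.toDual (M := t.fst.overEnd) (X := FDModule.dualHom t.fst t.snd)).symm.toAddEquiv)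
    (fun a x => LinearMap.ext fun η => bidualEquiv_smul h' h a x η)

theorem swap_AS_swap_involutive (h : IsFaithfullyBalanced t.snd)
    (h' : Function.Bijective (evalHom t.snd (W := t.fst))) :
    Equivalent t t.swap.AS.swap.swap.AS.swap :=
  .of_semilinear (s := t) (t := t.swap.AS.swap.swap.AS.swap) (bicommutantEquiv h)
    { Equiv.ofBijective _ h' with
      map_add' := fun x y => LinearMap.ext fun g : t.fst →ₗ[t.alg] t.snd => map_add g x y }
    (fun a x => LinearMap.ext fun g : t.fst →ₗ[t.alg] t.snd => map_smul g a x)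
    (AddEquiv.refl t.snd) (fun _ _ => rfl)

theorem IsCogenTriple.dualAS_dualAS (hk : 1 ≤ k) (h : t.IsCogenTriple k) :
    Equivalent t t.dualAS.dualAS :=
  AlgTriple.dualAS_dualAS (h.isGood hk).isFaithfullyBalanced
    (dualEval_bijective (dualHomEval_bijective_of_inAdd h.2.1))

theorem IsRestrictedTriple.dualAS_dualAS (h : t.IsRestrictedTriple k) :
    Equivalent t t.dualAS.dualAS :=
  AlgTriple.dualAS_dualAS h.2.1 (dualEval_bijective h.isGood.bijective)

theorem swap_AS_swap_swap_AS_swap (h : IsCotilting k t.snd)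
    (h' : ExtVanish t.alg t.fst t.snd) : Equivalent t t.swap.AS.swap.swap.AS.swap :=
  swap_AS_swap_involutive
    (h.isGood (.refl _ _) h.1 (.regular_left _ _)).isFaithfullyBalanced
    (h.isGood (.refl _ _) h.1 h').evalHom_bijective

/-- By duality an endomorphism of `D Hom(M, C)` is the transpose of an endomorphism of `Hom(M, C)`
as a right `End(M)`-module. As `C ∈ add M`, the latter is composition with a unique endomorphism of
`C`. -/
theorem dualHomMap_end_bijective {A : Type u} [Ring A] [Algebra K A] {M C : FDModule K A}
    (h : InAdd A M C) : Function.Bijective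
      (fun c : Module.End A C => (dualHomMap M c : Module.End (Module.End A M) (DualHom K M C))) := by
  have sep : ∀ {g g' : M →ₗ[A] C}, (∀ φ : DualHom K M C,
      DualHom.toDual φ g = DualHom.toDual φ g') → g = g' := fun {g g'} hg =>
    sub_eq_zero.mp ((Module.forall_dual_apply_eq_zero_iff K _).mp fun ξ => by
      rw [map_sub, sub_eq_zero]; exact hg (DualHom.toDual.symm ξ))
  obtain ⟨n, i, p, hip⟩ := h.exists_sum_comp
  constructor
  · intro c c' hcc
    have h1 : ∀ g : M →ₗ[A] C, c ∘ₗ g = c' ∘ₗ g := fun g => sep fun φ =>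
      congrArg (fun ψ => DualHom.toDual ψ g) (LinearMap.congr_fun hcc φ)
    refine LinearMap.ext fun x => ?_
    have h2 := LinearMap.congr_fun hip x
    simp only [LinearMap.sum_apply, LinearMap.comp_apply, LinearMap.id_apply] at h2
    rw [← h2, map_sum, map_sum]
    exact Finset.sum_congr rfl fun j _ => LinearMap.congr_fun (h1 (p j)) (i j x)
  · intro θ
    let ev := Module.evalEquiv K (M →ₗ[A] C)
    -- `τ` is the transpose of `θ`, defined through the bidual of `Hom(M, C)`.
    let τ : (M →ₗ[A] C) → (M →ₗ[A] C) := fun g => ev.symm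
      { toFun := fun φ => DualHom.toDual (θ (DualHom.toDual.symm φ)) g
        map_add' := fun φ ψ => by rw [map_add, map_add, map_add]; rfl
        map_smul' := fun c φ => by
          rw [map_smul, LinearMap.map_smul_of_tower, map_smul]; rfl }
    have hτ : ∀ (φ : DualHom K M C) g, DualHom.toDual φ (τ g) = DualHom.toDual (θ φ) g := by
      intro φ g
      exact congrArg (fun ψ => ψ (DualHom.toDual φ)) (ev.apply_symm_apply _)
    have hτs : ∀ g (γ : Module.End A M), τ (g ∘ₗ γ) = τ g ∘ₗ γ := fun g γ => sep fun φ => by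
      rw [hτ, ← DualHom.toDual_smul, ← DualHom.toDual_smul, hτ, θ.map_smul]
    have hτa : ∀ {ι : Type} (s : Finset ι) (g : ι → M →ₗ[A] C),
        τ (∑ j ∈ s, g j) = ∑ j ∈ s, τ (g j) := fun s g => sep fun φ => by
      rw [hτ, map_sum, map_sum]
      exact Finset.sum_congr rfl fun j _ => (hτ φ (g j)).symm
    -- This choice is forced: if `τ g = c ∘ g` for all `g`, then `c = ∑ c ∘ p j ∘ i j = ∑ τ (p j) ∘
    -- i j`.
    refine ⟨∑ j, τ (p j) ∘ₗ i j, LinearMap.ext fun φ => DualHom.ext fun g => ?_⟩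
    change DualHom.toDual φ ((∑ j, τ (p j) ∘ₗ i j) ∘ₗ g) = _
    rw [← hτ]
    congr 1
    have h1 : g = ∑ j, p j ∘ₗ (i j ∘ₗ g) := by
      refine LinearMap.ext fun x => ?_
      have := LinearMap.congr_fun hip (g x)
      simp only [LinearMap.sum_apply, LinearMap.comp_apply, LinearMap.id_apply] at this ⊢
      exact this.symm
    conv_rhs => rw [h1, hτa]
    refine LinearMap.ext fun x => ?_
    simp only [LinearMap.sum_apply, LinearMap.comp_apply]
    refine Finset.sum_congr rfl fun j _ => ?_
    rw [hτs]
    rfl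

/-- For `C` in `add M`, the algebra `End(C)` is opposite to the endomorphism algebra of
`D Hom(M, C)`. -/
noncomputable def endDualHomEquiv {A : Type u} [Ring A] [Algebra K A] {M C : FDModule K A}
    (h : InAdd A M C) :
    Module.End A C ≃ₐ[K] (Module.End (Module.End A M) (DualHom K M C))ᵐᵒᵖ :=
  AlgEquiv.ofBijective
    { toFun := fun c => MulOpposite.op (dualHomMap M c)
      map_one' := rfl
      map_mul' := fun c c' => rfl
      map_zero' := by
        refine congrArg MulOpposite.op (LinearMap.ext fun φ => DualHom.ext fun g => ?_)
        change DualHom.toDual φ (0 ∘ₗ g) = 0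
        rw [LinearMap.zero_comp, map_zero]
      map_add' := fun c c' => by
        refine congrArg MulOpposite.op (LinearMap.ext fun φ => DualHom.ext fun g => ?_)
        change DualHom.toDual φ ((c + c') ∘ₗ g) = _
        rw [LinearMap.add_comp, map_add]
        rfl
      commutes' := fun c => by
        refine congrArg MulOpposite.op (LinearMap.ext fun φ => DualHom.ext fun g => ?_)
        change DualHom.toDual φ (c • g) = _
        rw [map_smul]
        rfl }
    (MulOpposite.op_bijective.comp (dualHomMap_end_bijective h))

/-- With `J = D Hom(M, C)`, the three components match as `End(C) ≅ End(J)ᵒᵖ`, `Hom(M, C) ≅ D J` and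
`C ≅ D Hom_{End(M)}(M, J)`. -/
theorem triangle (h : InAdd t.alg t.fst t.snd) :
    Equivalent t.swap.AS.swap t.dualAS.swap.AS.op :=
  .of_semilinear (s := t.swap.AS.swap) (t := t.dualAS.swap.AS.op) (endDualHomEquiv h)
    (Module.evalEquiv K (t.fst →ₗ[t.alg] t.snd)).toAddEquiv (fun _ _ => rfl)
    (bidualEquiv (dualEval_bijective (dualHomEval_bijective_of_inAdd h))).toAddEquiv
    (fun c x => LinearMap.ext fun η => by
      obtain ⟨ζ, rfl⟩ := (dualEval_bijective (dualHomEval_bijective_of_inAdd h)).2 η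
      exact (bidualEquiv_apply_dualEval _ _ _).trans
        (bidualEquiv_apply_dualEval (dualEval_bijective (dualHomEval_bijective_of_inAdd h)) x
          (ζ ∘ₗ c.restrictScalars K)).symm)

end AlgTriple

/-! ### Endomorphism algebras of modules with the same additive closure -/

section MoritaHom

variable {K : Type u} [Field K] {A : Type u} [Ring A] [Algebra K A]

/-- For an `End(X)`-module `Y`, the `End(X')`-module `Hom_{End(X)}(Hom(X', X), Y)`. -/
def MoritaHom (X' X : FDModule K A) (Y : Type u) [AddCommGroup Y]
    [Module (Module.End A X) Y] : Type u :=
  (X' →ₗ[A] X) →ₗ[Module.End A X] Y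

namespace MoritaHom

variable (X' X : FDModule K A) (Y : Type u) [AddCommGroup Y] [Module (Module.End A X) Y]

instance : AddCommGroup (MoritaHom X' X Y) :=
  inferInstanceAs (AddCommGroup ((X' →ₗ[A] X) →ₗ[Module.End A X] Y))

variable {X' X Y}

/-- An element of `MoritaHom X' X Y` as a linear map. -/
def toHom : MoritaHom X' X Y ≃+ ((X' →ₗ[A] X) →ₗ[Module.End A X] Y) :=
  AddEquiv.refl _

theorem ext {φ ψ : MoritaHom X' X Y} (h : ∀ p, toHom φ p = toHom ψ p) : φ = ψ :=
  LinearMap.ext h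

instance : Module (Module.End A X') (MoritaHom X' X Y) where
  smul s φ := toHom.symm
    { toFun := fun p => toHom φ (p ∘ₗ s)
      map_add' := fun p q => by rw [LinearMap.add_comp, map_add]
      map_smul' := fun r p => (toHom φ).map_smul r (p ∘ₗ s) }
  one_smul _ := rfl
  mul_smul _ _ _ := rfl
  smul_zero _ := rfl
  smul_add _ _ _ := rfl
  add_smul s s' φ := ext fun p => by
    change toHom φ (p ∘ₗ (s + s')) = toHom φ (p ∘ₗ s) + toHom φ (p ∘ₗ s')
    rw [LinearMap.comp_add, map_add]
  zero_smul φ := ext fun p => by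
    change toHom φ (p ∘ₗ 0) = 0
    rw [LinearMap.comp_zero, map_zero]

@[simp]
theorem toHom_smul (s : Module.End A X') (φ : MoritaHom X' X Y) (p : X' →ₗ[A] X) :
    toHom (s • φ) p = toHom φ (p ∘ₗ s) := rfl

/-- Functoriality of `MoritaHom`. -/
def map {Z : Type u} [AddCommGroup Z] [Module (Module.End A X) Z]
    (f : Y →ₗ[Module.End A X] Z) : MoritaHom X' X Y →ₗ[Module.End A X'] MoritaHom X' X Z where
  toFun φ := toHom.symm (f ∘ₗ toHom φ)
  map_add' _ _ := ext fun _ => map_add f _ _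
  map_smul' _ _ := rfl

variable (X' X Y) in
/-- The natural map from `Y` to the double `MoritaHom` module. -/
def unit : Y →ₗ[Module.End A X] MoritaHom X X' (MoritaHom X' X Y) where
  toFun y := toHom.symm
    { toFun := fun q => toHom.symm
        { toFun := fun p => (show Module.End A X from p ∘ₗ q) • y
          map_add' := fun p p' => add_smul (show Module.End A X from p ∘ₗ q) (p' ∘ₗ q) y
          map_smul' := fun r p => mul_smul r (show Module.End A X from p ∘ₗ q) y }
      map_add' := fun q q' => ext fun p => by
        change (show Module.End A X from p ∘ₗ (q + q')) • y = _
        rw [LinearMap.comp_add]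
        exact add_smul (show Module.End A X from p ∘ₗ q) (p ∘ₗ q') y
      map_smul' := fun s q => rfl }
  map_add' y y' := ext fun q => ext fun p => smul_add (show Module.End A X from p ∘ₗ q) y y'
  map_smul' r y := ext fun q => ext fun p =>
    (mul_smul (show Module.End A X from p ∘ₗ q) r y).symm

@[simp]
theorem toHom_toHom_unit (y : Y) (q : X →ₗ[A] X') (p : X' →ₗ[A] X) :
    toHom (toHom (unit X' X Y y) q) p = (show Module.End A X from p ∘ₗ q) • y := rfl

theorem unit_bijective (h : InAdd A X' X) : Function.Bijective (unit X' X Y) := by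
  obtain ⟨n, i, p, h⟩ := h.exists_sum_comp
  -- The partition of unity `1 = ∑ p j ∘ i j` in `End(X)` recovers `y` from the values of its image
  -- at the pairs `(i j, p j)`.
  have h1 : ∑ j, (show Module.End A X from p j ∘ₗ i j) = 1 := h
  constructor
  · refine (injective_iff_map_eq_zero _).mpr fun y hy => ?_
    rw [← one_smul (Module.End A X) y, ← h1, Finset.sum_smul]
    refine Finset.sum_eq_zero fun j _ => ?_
    rw [← toHom_toHom_unit, hy]
    rfl
  · intro Φ
    refine ⟨∑ j, toHom (toHom Φ (i j)) (p j), ext fun q => ext fun p' => ?_⟩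
    rw [toHom_toHom_unit, Finset.smul_sum]
    have h2 : ∀ j, (show Module.End A X from p' ∘ₗ q) • toHom (toHom Φ (i j)) (p j) =
        toHom (toHom Φ (q ∘ₗ (p j ∘ₗ i j))) p' := by
      intro j
      rw [← (toHom (toHom Φ (i j))).map_smul]
      change toHom (toHom Φ (i j)) (p' ∘ₗ (q ∘ₗ p j)) = _
      rw [← toHom_smul (q ∘ₗ p j) (toHom Φ (i j)) p', ← (toHom Φ).map_smul]
      rfl
    simp only [h2]
    have h3 : q = ∑ j, q ∘ₗ (p j ∘ₗ i j) := by
      refine LinearMap.ext fun x => ?_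
      have := LinearMap.congr_fun h x
      simp only [LinearMap.sum_apply, LinearMap.comp_apply, LinearMap.id_apply] at this ⊢
      rw [← map_sum, this]
    conv_rhs => rw [h3, map_sum, map_sum, LinearMap.sum_apply]

variable (X' X) in
/-- The functor `Hom_{End(X)}(Hom(X', X), -)`. -/
def functor : ModuleCat.{u} (Module.End A X) ⥤ ModuleCat.{u} (Module.End A X') where
  obj Y := ModuleCat.of _ (MoritaHom X' X Y)
  map f := ModuleCat.ofHom (map f.hom)

/-- If `X ∈ add X'`, then the two functors `MoritaHom` compose to the identity. -/
noncomputable def unitIso (h : InAdd A X' X) :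
    𝟭 (ModuleCat.{u} (Module.End A X)) ≅ functor X' X ⋙ functor X X' :=
  NatIso.ofComponents
    (fun Y => (LinearEquiv.ofBijective (unit X' X Y) (unit_bijective h)).toModuleIso)
    (fun f => ModuleCat.hom_ext (LinearMap.ext fun y => ext fun q => ext fun p =>
      (f.hom.map_smul (show Module.End A X from p ∘ₗ q) y).symm))

open scoped ModuleCat.Algebra

variable (X' X) in
/-- If `X` and `X'` have the same additive closure, then `End(X)` and `End(X')` are Morita
equivalent. -/
noncomputable def moritaEquivalence (h : InAdd A X' X) (h' : InAdd A X X') :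
    MoritaEquivalence K (Module.End A X) (Module.End A X') where
  -- The two isomorphisms are one construction with `X` and `X'` exchanged; no triangle identity has
  -- to be checked.
  eqv := CategoryTheory.Equivalence.mk (functor X' X) (functor X X') (unitIso h) (unitIso h').symm
  linear :=
    { map_smul := fun {Y Z} f c => ModuleCat.hom_ext (LinearMap.ext fun φ => ext fun p => by
        have h1 : p ∘ₗ algebraMap K (Module.End A X') c =
            algebraMap K (Module.End A X) c • p :=
          LinearMap.ext fun x => LinearMap.map_smul_of_tower p c x
        change algebraMap K (Module.End A X) c • f.hom (toHom φ p) =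
          f.hom (toHom φ (p ∘ₗ algebraMap K (Module.End A X') c))
        rw [h1, map_smul, map_smul]) }

/-- The isomorphism `Hom(U, X') ≃ Hom_{End(X)}(Hom(X', X), Hom(U, X))` for `X'` in `add X`. -/
noncomputable def homIntoEquiv (h' : InAdd A X X') (U : FDModule K A) :
    (U →ₗ[A] X') ≃ₗ[Module.End A X'] MoritaHom X' X (U →ₗ[A] X) :=
  .ofBijective
    { toFun := fun h => toHom.symm
        { toFun := fun p => p ∘ₗ h
          map_add' := fun _ _ => rfl
          map_smul' := fun _ _ => rfl }
      map_add' := fun h h' => ext fun p => LinearMap.comp_add h h' p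
      map_smul' := fun _ _ => rfl }
    (by
      obtain ⟨n, b, a, hab⟩ := h'.exists_sum_comp
      constructor
      · intro h h' hh
        refine LinearMap.ext fun x => ?_
        rw [← LinearMap.id_apply (R := A) (h x), ← LinearMap.id_apply (R := A) (h' x), ← hab,
          LinearMap.sum_apply, LinearMap.sum_apply]
        refine Finset.sum_congr rfl fun j _ => congrArg (a j) ?_
        exact LinearMap.congr_fun (congrArg (fun φ => toHom φ (b j)) hh) x
      · intro φ
        refine ⟨∑ j, a j ∘ₗ toHom φ (b j), ext fun p => ?_⟩
        -- The `b j` generate `Hom(X', X)` over `End(X)`, with coefficients `p ∘ a j`, so `φ` is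
        -- determined by its values on them.
        have h1 : p = ∑ j, (show Module.End A X from p ∘ₗ a j) • b j := by
          refine LinearMap.ext fun x => ?_
          have := LinearMap.congr_fun hab x
          simp only [LinearMap.sum_apply, LinearMap.comp_apply, LinearMap.id_apply,
            LinearMap.smul_apply, Module.End.smul_def] at this ⊢
          rw [← map_sum, this]
        conv_rhs => rw [h1, map_sum]
        change p ∘ₗ (∑ j, a j ∘ₗ toHom φ (b j)) = _
        refine LinearMap.ext fun x => ?_
        simp only [LinearMap.sum_apply, LinearMap.comp_apply, map_sum, map_smul,
          LinearMap.smul_apply, Module.End.smul_def])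

/-- The isomorphism `D Hom(X', U) ≃ Hom_{End(X)}(Hom(X', X), D Hom(X, U))` for `X'` in `add X`. -/
noncomputable def dualHomEquiv (h' : InAdd A X X') (U : FDModule K A) :
    DualHom K X' U ≃ₗ[Module.End A X'] MoritaHom X' X (DualHom K X U) :=
  .ofBijective
    { toFun := fun ξ => toHom.symm (dualHomEval X X' U ξ)
      map_add' := fun _ _ => rfl
      map_smul' := fun _ _ => rfl }
    (by
      obtain ⟨n, b, a, hab⟩ := h'.exists_sum_comp
      have hf : ∀ f : X' →ₗ[A] U, ∑ j, f ∘ₗ a j ∘ₗ b j = f := fun f => by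
        refine LinearMap.ext fun x => ?_
        have := LinearMap.congr_fun hab x
        simp only [LinearMap.sum_apply, LinearMap.comp_apply, LinearMap.id_apply] at this ⊢
        rw [← map_sum, this]
      constructor
      · intro ξ ξ' hh
        refine DualHom.ext fun f => ?_
        rw [← hf f, map_sum, map_sum]
        exact Finset.sum_congr rfl fun j _ =>
          congrArg (fun φ => DualHom.toDual (toHom φ (b j)) (f ∘ₗ a j)) hh
      · intro η
        refine ⟨DualHom.toDual.symm
          (∑ j, DualHom.toDual (toHom η (b j)) ∘ₗ
            { toFun := fun f => f ∘ₗ a j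
              map_add' := fun _ _ => rfl
              map_smul' := fun _ _ => rfl }), ext fun p => DualHom.ext fun f => ?_⟩
        have h1 : p = ∑ j, (show Module.End A X from p ∘ₗ a j) • b j := by
          refine LinearMap.ext fun x => ?_
          have := LinearMap.congr_fun hab x
          simp only [LinearMap.sum_apply, LinearMap.comp_apply, LinearMap.id_apply,
            LinearMap.smul_apply, Module.End.smul_def] at this ⊢
          rw [← map_sum, this]
        conv_rhs => rw [h1, map_sum, map_sum, LinearMap.sum_apply]
        change (∑ j, DualHom.toDual (toHom η (b j)) ∘ₗ
            { toFun := fun f => f ∘ₗ a j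
              map_add' := fun _ _ => rfl
              map_smul' := fun _ _ => rfl } : Module.Dual K (X' →ₗ[A] U)) (f ∘ₗ p) = _
        rw [LinearMap.sum_apply]
        refine Finset.sum_congr rfl fun j _ => ?_
        rw [(toHom η).map_smul, DualHom.toDual_smul]
        rfl)

end MoritaHom

end MoritaHom

/-! ### Morita equivalences and additive closures -/

section AddCorr

variable {K : Type u} [Field K] {A B : Type u} [Ring A] [Algebra K A] [Ring B] [Algebra K B]

namespace MoritaEquivalence

variable (e : MoritaEquivalence K A B)

theorem inAdd_map {M X : ModuleCat.{u} A} (h : InAdd A M X) :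
    InAdd B (e.eqv.functor.obj M) (e.eqv.functor.obj X) := by
  obtain ⟨n, i, p, h⟩ := h.exists_sum_comp
  refine .of_sum_comp (fun j => (e.eqv.functor.map (ModuleCat.ofHom (i j))).hom)
    (fun j => (e.eqv.functor.map (ModuleCat.ofHom (p j))).hom) ?_
  have h1 : ∑ j, ModuleCat.ofHom (i j) ≫ ModuleCat.ofHom (p j) = 𝟙 X := by
    rw [← ModuleCat.ofHom_id, ← h, ModuleCat.ofHom_sum]
    rfl
  have h2 := congrArg e.eqv.functor.map h1
  rw [Functor.map_sum, CategoryTheory.Functor.map_id] at h2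
  have h3 := congrArg ModuleCat.Hom.hom h2
  rw [ModuleCat.hom_sum, ModuleCat.hom_id] at h3
  rw [← h3]
  refine Finset.sum_congr rfl fun j _ => ?_
  rw [Functor.map_comp, ModuleCat.hom_comp]

theorem inAdd_map_symm {M : ModuleCat.{u} A} {Y : ModuleCat.{u} B}
    (h : InAdd B (e.eqv.functor.obj M) Y) : InAdd A M (e.eqv.inverse.obj Y) :=
  (e.symm.inAdd_map h).of_equiv_left (e.eqv.unitIso.app M).toLinearEquiv.symm

theorem inAdd_map_iff {M X : ModuleCat.{u} A} :
    InAdd A M X ↔ InAdd B (e.eqv.functor.obj M) (e.eqv.functor.obj X) :=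
  ⟨e.inAdd_map, fun h => (e.inAdd_map_symm h).of_equiv (e.eqv.unitIso.app X).toLinearEquiv.symm⟩

/-- The Morita equivalence `e` maps `M` to a module with the same additive closure as `M'`. -/
structure AddCorr (M M' : Type u) [AddCommGroup M] [Module A M] [AddCommGroup M'] [Module B M'] :
    Prop where
  left : InAdd B M' (e.eqv.functor.obj (ModuleCat.of A M))
  right : InAdd B (e.eqv.functor.obj (ModuleCat.of A M)) M'

variable {e} {M N M' N' : Type u} [AddCommGroup M] [Module A M] [AddCommGroup N] [Module A N]
  [AddCommGroup M'] [Module B M'] [AddCommGroup N'] [Module B N']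

theorem AddCorr.inAdd_iff (h : e.AddCorr M M') (X : ModuleCat.{u} A) :
    InAdd A M X ↔ InAdd B M' (e.eqv.functor.obj X) :=
  (e.inAdd_map_iff (M := ModuleCat.of A M)).trans ⟨h.left.trans, h.right.trans⟩

theorem AddCorr.of_inAdd_iff (h : ∀ X : ModuleCat.{u} A,
    InAdd A M X ↔ InAdd B M' (e.eqv.functor.obj X)) : e.AddCorr M M' where
  left := (h (ModuleCat.of A M)).mp (.refl A M)
  right := by
    let ε := (e.eqv.counitIso.app (ModuleCat.of B M')).toLinearEquiv
    have h1 : InAdd A M (e.eqv.inverse.obj (ModuleCat.of B M')) :=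
      (h _).mpr ((InAdd.refl B M').of_equiv ε.symm)
    exact (e.inAdd_map (M := ModuleCat.of A M) h1).of_equiv ε

theorem AddCorr.trans {C : Type u} [Ring C] [Algebra K C] {M'' : Type u} [AddCommGroup M'']
    [Module C M''] {e' : MoritaEquivalence K B C} (h : e.AddCorr M M') (h' : e'.AddCorr M' M'') :
    (MoritaEquivalence.trans K e e').AddCorr M M'' :=
  .of_inAdd_iff fun X => (h.inAdd_iff X).trans (h'.inAdd_iff _)

theorem AddCorr.of_equiv (f : M ≃ₗ[A] N) (f' : M' ≃ₗ[B] N') (h : e.AddCorr M M') :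
    e.AddCorr N N' := by
  refine .of_inAdd_iff fun X => ?_
  refine Iff.trans ⟨InAdd.of_equiv_left f.symm, InAdd.of_equiv_left f⟩ ((h.inAdd_iff X).trans ?_)
  exact ⟨InAdd.of_equiv_left f', InAdd.of_equiv_left f'.symm⟩

theorem AddCorr.of_semilinear (σ : A ≃ₐ[K] B) (f : M ≃+ M')
    (hf : ∀ a x, f (a • x) = σ a • f x) : (MoritaEquivalence.ofAlgEquiv σ).AddCorr M M' :=
  .of_inAdd_iff (ofAlgEquiv_inAdd_iff σ f hf)

/-- The image `P` of `A` is a generator: if the trace ideal `T` of `P` in `B` is everything, then `1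
= ∑ f j (y j)` makes `B` a summand of a power of `P`. -/
theorem inAdd_functor_regular (e : MoritaEquivalence K A B) :
    InAdd B (e.eqv.functor.obj (ModuleCat.of A A)) B := by
  set P := e.eqv.functor.obj (ModuleCat.of A A) with hP
  let T : Submodule B B := ⨆ f : P →ₗ[B] B, LinearMap.range f
  let q : ModuleCat.of B B ⟶ ModuleCat.of B (B ⧸ T) := ModuleCat.ofHom T.mkQ
  have hq : ∀ f : P ⟶ ModuleCat.of B B, f ≫ q = 0 := fun f =>
    ModuleCat.hom_ext (LinearMap.ext fun x =>
      (Submodule.Quotient.mk_eq_zero T).mpr (Submodule.mem_iSup_of_mem f.hom ⟨x, rfl⟩))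
  -- Elements of a module are maps from `A`, and by adjunction these correspond to maps `P → B`, all
  -- of which `q` kills. Faithfulness of the inverse then gives `q = 0`.
  have hq0 : e.eqv.inverse.map q = 0 := by
    refine ModuleCat.hom_ext (LinearMap.ext fun x => ?_)
    let g : ModuleCat.of A A ⟶ e.eqv.inverse.obj (ModuleCat.of B B) :=
      ModuleCat.ofHom (LinearMap.toSpanSingleton A _ x)
    have h1 : g ≫ e.eqv.inverse.map q = 0 := by
      refine (e.eqv.toAdjunction.homEquiv _ _).symm.injective ?_
      rw [Adjunction.homEquiv_naturality_right_symm, hq]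
      simp [Adjunction.homEquiv_symm_apply]
    have h2 : e.eqv.inverse.map q ((1 : A) • x) = 0 :=
      congrArg (fun h => h.hom (1 : A)) h1
    rw [one_smul] at h2
    exact h2
  have hq1 : q = 0 := e.eqv.inverse.map_injective (hq0.trans (Functor.map_zero _ _ _).symm)
  have h1 : (1 : B) ∈ T := (Submodule.Quotient.mk_eq_zero T).mp
    (congrArg (fun h => h.hom (1 : B)) hq1)
  obtain ⟨c, hc, hc'⟩ := (Submodule.mem_iSup_iff_exists_finsupp _ _).mp h1
  choose y hy using hc
  refine .of_sum_comp' (ι := c.support) (fun j => LinearMap.toSpanSingleton B P (y j))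
    (fun j => (j : P →ₗ[B] B)) ?_
  apply LinearMap.ext_ring
  rw [LinearMap.sum_apply, LinearMap.id_apply]
  refine Eq.trans ?_ hc'
  refine (Finset.sum_congr rfl fun j _ => ?_).trans (Finset.sum_coe_sort c.support fun a => c a)
  change (j : P →ₗ[B] B) ((1 : B) • y j) = _
  rw [one_smul, hy]

theorem AddCorr.regular (e : MoritaEquivalence K A B) : e.AddCorr A B where
  left := (e.inAdd_map (M := e.eqv.inverse.obj (ModuleCat.of B B)) (X := ModuleCat.of A A)
    e.symm.inAdd_functor_regular).of_equiv_left
      (e.eqv.counitIso.app (ModuleCat.of B B)).toLinearEquiv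
  right := e.inAdd_functor_regular

end MoritaEquivalence

theorem AlgTriple.equivalent_iff {s t : AlgTriple K} : AlgTriple.Equivalent s t ↔
    ∃ e : MoritaEquivalence K s.alg t.alg, e.AddCorr s.fst t.fst ∧ e.AddCorr s.snd t.snd :=
  ⟨fun ⟨e, h₁, h₂⟩ => ⟨e, .of_inAdd_iff h₁, .of_inAdd_iff h₂⟩,
    fun ⟨e, h₁, h₂⟩ => ⟨e, h₁.inAdd_iff, h₂.inAdd_iff⟩⟩

/-! ### Transport of homomorphisms along a Morita equivalence -/

/-- A module over `B` in the additive closure of a finite-dimensional module, as a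
finite-dimensional module. -/
noncomputable def FDModule.ofInAdd {M : FDModule K B} {X : ModuleCat.{u} B} (h : InAdd B M X) :
    FDModule K B :=
  let : Module K X := Module.compHom X (algebraMap K B)
  have : IsScalarTower K B X := ⟨fun c b x => by rw [Algebra.smul_def, mul_smul]; rfl⟩
  have : Module.Finite K X := h.finite
  ⟨X⟩

namespace MoritaEquivalence

variable (e : MoritaEquivalence K A B) {U V X : FDModule K A} {U' V' X' : FDModule K B}
  (hU : InAdd B U' (e.eqv.functor.obj U.toModuleCat))
  (hV : InAdd B V' (e.eqv.functor.obj V.toModuleCat))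

open scoped ModuleCat.Algebra in
theorem map_hom_apply_of_smul {X Y : ModuleCat.{u} A} {f g : X ⟶ Y} {c : K}
    (h : ∀ x, g.hom x = algebraMap K A c • f.hom x) (y : e.eqv.functor.obj X) :
    (e.eqv.functor.map g).hom y = algebraMap K B c • (e.eqv.functor.map f).hom y := by
  obtain rfl : g = c • f := ModuleCat.hom_ext (LinearMap.ext h)
  rw [Functor.map_smul]
  rfl

/-- A Morita equivalence induces isomorphisms on spaces of homomorphisms. -/
noncomputable def homEquiv : (U →ₗ[A] V) ≃ₗ[K]
    (FDModule.ofInAdd hU →ₗ[B] FDModule.ofInAdd hV) where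
  toFun f := (e.eqv.functor.map (ModuleCat.ofHom f)).hom
  invFun g := (e.eqv.functor.preimage (X := U.toModuleCat) (Y := V.toModuleCat)
    (ModuleCat.ofHom g)).hom
  map_add' f g := congrArg ModuleCat.Hom.hom
    (e.eqv.functor.map_add (f := ModuleCat.ofHom f) (g := ModuleCat.ofHom g))
  map_smul' c f := LinearMap.ext fun y => (e.map_hom_apply_of_smul
    (f := ModuleCat.ofHom f) (g := ModuleCat.ofHom (c • f))
    (fun x => (algebraMap_smul A c (f x)).symm) y).trans
    (algebraMap_smul (M := FDModule.ofInAdd hV) B c _)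
  left_inv f := congrArg ModuleCat.Hom.hom (e.eqv.functor.preimage_map (ModuleCat.ofHom f))
  right_inv g := congrArg ModuleCat.Hom.hom (e.eqv.functor.map_preimage (X := U.toModuleCat)
    (Y := V.toModuleCat) (ModuleCat.ofHom g))

end MoritaEquivalence

end AddCorr

/-! ### Endomorphism algebras along a Morita equivalence -/

section Transport

variable {K : Type u} [Field K] {A B : Type u} [Ring A] [Algebra K A] [Ring B] [Algebra K B]

namespace MoritaEquivalence

variable (e : MoritaEquivalence K A B) {U V W X : FDModule K A} {U' V' W' X' : FDModule K B}

theorem homEquiv_comp (hU : InAdd B U' (e.eqv.functor.obj U.toModuleCat))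
    (hV : InAdd B V' (e.eqv.functor.obj V.toModuleCat))
    (hW : InAdd B W' (e.eqv.functor.obj W.toModuleCat)) (f : U →ₗ[A] V) (g : V →ₗ[A] W) :
    e.homEquiv hU hW (g ∘ₗ f) = e.homEquiv hV hW g ∘ₗ e.homEquiv hU hV f :=
  congrArg ModuleCat.Hom.hom (e.eqv.functor.map_comp (ModuleCat.ofHom f) (ModuleCat.ofHom g))

/-- A Morita equivalence induces isomorphisms of endomorphism algebras. -/
noncomputable def endEquiv (hX : InAdd B X' (e.eqv.functor.obj X.toModuleCat)) :
    Module.End A X ≃ₐ[K] Module.End B (FDModule.ofInAdd hX) :=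
  AlgEquiv.ofLinearEquiv (e.homEquiv hX hX)
    (congrArg ModuleCat.Hom.hom (e.eqv.functor.map_id X.toModuleCat))
    (fun f g => e.homEquiv_comp hX hX hX g f)

/-- The equivalence is composed of two: `e` identifies `End(X)` with `End(e X)`, and `MoritaHom`
connects `End(e X)` to `End(X')`, since `e X` and `X'` have the same additive closure. -/
theorem exists_addCorr_end (hX : e.AddCorr X X') :
    ∃ e' : MoritaEquivalence K (Module.End A X) (Module.End B X'),
      (∀ (U : FDModule K A) (U' : FDModule K B), e.AddCorr U U' →
        e'.AddCorr (U →ₗ[A] X) (U' →ₗ[B] X')) ∧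
      ∀ (U : FDModule K A) (U' : FDModule K B), e.AddCorr U U' →
        e'.AddCorr (DualHom K X U) (DualHom K X' U') := by
  let σ := e.endEquiv hX.left
  refine ⟨MoritaEquivalence.trans K (.ofAlgEquiv σ)
    (MoritaHom.moritaEquivalence X' (FDModule.ofInAdd hX.left) hX.left hX.right), ?_, ?_⟩
  · intro U U' hU
    refine AddCorr.trans (AddCorr.of_semilinear σ (e.homEquiv hU.left hX.left).toAddEquiv
      fun a f => e.homEquiv_comp hU.left hX.left hX.left f a) ?_
    let T := MoritaHom.homIntoEquiv (X := FDModule.ofInAdd hX.left) hX.right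
      (FDModule.ofInAdd hU.left)
    exact ⟨(InAdd.homInto (Y := FDModule.ofInAdd hU.left) hU.left).of_equiv T,
      (InAdd.homInto (X := FDModule.ofInAdd hU.left) hU.right).of_equiv_left T⟩
  · intro U U' hU
    let f : DualHom K X U ≃+ DualHom K (FDModule.ofInAdd hX.left) (FDModule.ofInAdd hU.left) :=
      (DualHom.toDual.trans
        ((e.homEquiv hX.left hU.left).symm.dualMap.trans DualHom.toDual.symm)).toAddEquiv
    have hf : ∀ (a : Module.End A X) (φ : DualHom K X U), f (a • φ) = σ a • f φ := fun a φ => ?_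
    · refine AddCorr.trans (AddCorr.of_semilinear σ f hf) ?_
      let T := MoritaHom.dualHomEquiv (X := FDModule.ofInAdd hX.left) hX.right
        (FDModule.ofInAdd hU.left)
      exact ⟨(InAdd.dualHom (Y := FDModule.ofInAdd hU.left) hU.left).of_equiv T,
        (InAdd.dualHom (X := FDModule.ofInAdd hU.left) hU.right).of_equiv_left T⟩
    · refine DualHom.ext fun g => ?_
      obtain ⟨f, rfl⟩ := (e.homEquiv hX.left hU.left).surjective g
      change DualHom.toDual φ ((e.homEquiv hX.left hU.left).symm _ ∘ₗ a) =
        DualHom.toDual φ ((e.homEquiv hX.left hU.left).symm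
          (e.homEquiv hX.left hU.left f ∘ₗ e.homEquiv hX.left hX.left a))
      rw [← e.homEquiv_comp, LinearEquiv.symm_apply_apply, LinearEquiv.symm_apply_apply]

end MoritaEquivalence

end Transport

/-! ### The assignments respect equivalence of triples -/

namespace AlgTriple

variable {K : Type u} [Field K] {s t : AlgTriple K}

theorem Equivalent.swap (h : Equivalent s t) : Equivalent s.swap t.swap := by
  obtain ⟨e, h₁, h₂⟩ := h
  exact ⟨e, h₂, h₁⟩

theorem Equivalent.AS (h : Equivalent s t) : Equivalent s.AS t.AS := by
  obtain ⟨e, h₁, h₂⟩ := equivalent_iff.mp h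
  obtain ⟨e', h₃, -⟩ := e.exists_addCorr_end h₁
  -- The module `M` over `End(M)` is `Hom(A, M)`, and regular modules correspond under a Morita
  -- equivalence up to `add`.
  have h₅ : e'.AddCorr s.fst t.fst := (h₃ (FDModule.regular K s.alg) (FDModule.regular K t.alg)
    (.regular e)).of_equiv (homRegularEquiv s.fst) (homRegularEquiv t.fst)
  exact equivalent_iff.mpr ⟨e', h₅, h₃ _ _ h₂⟩

theorem Equivalent.dualAS (h : Equivalent s t) : Equivalent s.dualAS t.dualAS := by
  obtain ⟨e, h₁, h₂⟩ := equivalent_iff.mp h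
  obtain ⟨e', h₃, h₄⟩ := e.exists_addCorr_end h₁
  have h₅ : e'.AddCorr s.fst t.fst := (h₃ (FDModule.regular K s.alg) (FDModule.regular K t.alg)
    (.regular e)).of_equiv (homRegularEquiv s.fst) (homRegularEquiv t.fst)
  exact equivalent_iff.mpr ⟨e', h₅, h₄ _ _ h₂⟩

/-- The triple `(End(A), D Hom(A, M), D Hom(A, G))`, which is isomorphic to `(Aᵒᵖ, D M, D G)`. -/
noncomputable def dualHomRegular (t : AlgTriple K) : AlgTriple K where
  alg := Module.End t.alg (FDModule.regular K t.alg)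
  fst := FDModule.dualHom (FDModule.regular K t.alg) t.fst
  snd := FDModule.dualHom (FDModule.regular K t.alg) t.snd

/-- The isomorphism `D Hom(A, X) ≃ D X`. -/
noncomputable def dualHomRegularEquiv {A : Type u} [Ring A] [Algebra K A] [Module.Finite K A]
    (X : FDModule K A) : OpDual K X ≃+ DualHom K (FDModule.regular K A) X where
  toFun φ := DualHom.toDual.symm
    { toFun := fun f => (show X →ₗ[K] K from φ) (f (1 : A))
      map_add' := fun f g => map_add (show X →ₗ[K] K from φ) (f (1 : A)) (g (1 : A))
      map_smul' := fun c f => map_smul (show X →ₗ[K] K from φ) c (f (1 : A)) }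
  invFun ψ := (
    { toFun := fun x => DualHom.toDual ψ (LinearMap.toSpanSingleton A X x)
      map_add' := fun x y => by rw [LinearMap.toSpanSingleton_add, map_add]
      map_smul' := fun c x => by
        rw [RingHom.id_apply, ← map_smul]
        congr 1
        ext
        simp } : X →ₗ[K] K)
  map_add' _ _ := rfl
  left_inv φ := by
    refine LinearMap.ext fun x => ?_
    change (show X →ₗ[K] K from φ) ((1 : A) • x) = _
    rw [one_smul]
  right_inv ψ := by
    refine DualHom.ext fun f => ?_
    change DualHom.toDual ψ _ = _
    congr 1
    ext
    exact one_smul A _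

theorem equivalent_op_dualHomRegular : Equivalent t.op t.dualHomRegular := by
  let σ : t.algᵐᵒᵖ ≃ₐ[K] Module.End t.alg (FDModule.regular K t.alg) := .moduleEndSelf K
  have hs : ∀ (X : FDModule K t.alg) (a : t.algᵐᵒᵖ) (φ : OpDual K X)
      (f : FDModule.regular K t.alg →ₗ[t.alg] X),
      DualHom.toDual (dualHomRegularEquiv X (a • φ)) f =
        DualHom.toDual (dualHomRegularEquiv X φ) (f ∘ₗ σ a) := by
    intro X a φ f
    change (show X →ₗ[K] K from φ) (a.unop • f (1 : t.alg)) =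
      (show X →ₗ[K] K from φ) (f ((1 : t.alg) * a.unop))
    rw [← map_smul, smul_eq_mul, mul_one, one_mul]
  exact .of_semilinear (s := t.op) (t := t.dualHomRegular)
    σ (dualHomRegularEquiv t.fst) (fun a φ => DualHom.ext (hs t.fst a φ))
    (dualHomRegularEquiv t.snd) (fun a φ => DualHom.ext (hs t.snd a φ))

/-- Duality is the functor `D Hom(A, -)` over `End(A) ≅ Aᵒᵖ`, so this is the transport of
endomorphism algebras applied to the regular modules. -/
theorem Equivalent.op (h : Equivalent s t) : Equivalent s.op t.op := by
  obtain ⟨e, h₁, h₂⟩ := equivalent_iff.mp h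
  obtain ⟨e', -, h₄⟩ := e.exists_addCorr_end (X := FDModule.regular K s.alg)
    (X' := FDModule.regular K t.alg) (.regular e)
  have : Equivalent s.dualHomRegular t.dualHomRegular :=
    equivalent_iff.mpr ⟨e', h₄ _ _ h₁, h₄ _ _ h₂⟩
  exact equivalent_op_dualHomRegular.trans (this.trans equivalent_op_dualHomRegular.symm)

end AlgTriple

/-! ### The bijections -/

section ClassesOf

variable {K : Type u} [Field K]

/-- Assignments on triples that respect equivalence and are mutually inverse up to equivalence on
the triples with properties `P` and `Q` induce a bijection of the sets of classes. -/
def classesOfEquiv {P Q : AlgTriple K → Prop} (f g : AlgTriple K → AlgTriple K)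
    (hf : ∀ s t, AlgTriple.Equivalent s t → AlgTriple.Equivalent (f s) (f t))
    (hg : ∀ s t, AlgTriple.Equivalent s t → AlgTriple.Equivalent (g s) (g t))
    (hPQ : ∀ t, P t → Q (f t)) (hQP : ∀ t, Q t → P (g t))
    (hgf : ∀ t, P t → AlgTriple.Equivalent t (g (f t)))
    (hfg : ∀ t, Q t → AlgTriple.Equivalent t (f (g t))) :
    classesOf P ≃ classesOf Q where
  toFun c := ⟨Quotient.map f hf c, by
    obtain ⟨_, t, ht, rfl⟩ := c
    exact ⟨f t, hPQ t ht, rfl⟩⟩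
  invFun c := ⟨Quotient.map g hg c, by
    obtain ⟨_, t, ht, rfl⟩ := c
    exact ⟨g t, hQP t ht, rfl⟩⟩
  left_inv := by
    rintro ⟨_, t, ht, rfl⟩
    exact Subtype.ext (Quotient.sound (hgf t ht).symm)
  right_inv := by
    rintro ⟨_, t, ht, rfl⟩
    exact Subtype.ext (Quotient.sound (hfg t ht).symm)

end ClassesOf

theorem mainTheorem10 (K : Type u) [Field K] (k : ℕ) (hk : 1 ≤ k) :
    ∃ (φ₁₂ : classesOf (AlgTriple.IsCogenTriple (K := K) k) ≃
          classesOf (AlgTriple.IsRestrictedTriple (K := K) k))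
      (φ₁₃ : classesOf (AlgTriple.IsCogenTriple (K := K) k) ≃
          classesOf (AlgTriple.IsGeneratorTriple (K := K) k))
      (φ₂₃ : classesOf (AlgTriple.IsRestrictedTriple (K := K) k) ≃
          classesOf (AlgTriple.IsGeneratorTriple (K := K) k)),
      (∀ (t : AlgTriple K) (ht : ⟦t⟧ ∈ classesOf (AlgTriple.IsCogenTriple (K := K) k)),
        (φ₁₂ ⟨⟦t⟧, ht⟩ : TripleClass K) = ⟦t.dualAS⟧) ∧
      (∀ (t : AlgTriple K) (ht : ⟦t⟧ ∈ classesOf (AlgTriple.IsCogenTriple (K := K) k)),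
        (φ₁₃ ⟨⟦t⟧, ht⟩ : TripleClass K) = ⟦t.swap.AS.swap⟧) ∧
      (∀ (t : AlgTriple K) (ht : ⟦t⟧ ∈ classesOf (AlgTriple.IsRestrictedTriple (K := K) k)),
        (φ₂₃ ⟨⟦t⟧, ht⟩ : TripleClass K) = ⟦t.swap.AS.op⟧) ∧
      ∀ c, φ₂₃ (φ₁₂ c) = φ₁₃ c := by
  let φ₁₂ : classesOf (AlgTriple.IsCogenTriple (K := K) k) ≃
      classesOf (AlgTriple.IsRestrictedTriple (K := K) k) :=
    classesOfEquiv AlgTriple.dualAS AlgTriple.dualAS (fun _ _ h => h.dualAS)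
      (fun _ _ h => h.dualAS) (fun _ h => h.dualAS hk) (fun _ h => h.dualAS hk)
      (fun _ h => h.dualAS_dualAS hk) (fun _ h => h.dualAS_dualAS)
  let φ₁₃ : classesOf (AlgTriple.IsCogenTriple (K := K) k) ≃
      classesOf (AlgTriple.IsGeneratorTriple (K := K) k) :=
    classesOfEquiv (fun t => t.swap.AS.swap) (fun t => t.swap.AS.swap)
      (fun _ _ h => h.swap.AS.swap) (fun _ _ h => h.swap.AS.swap)
      (fun _ h => h.swap_AS_swap hk) (fun _ h => h.swap_AS_swap hk)
      (fun _ h => by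
        obtain ⟨h₁, -, h₃⟩ := (AlgTriple.isCogenTriple_iff hk).mp h
        exact AlgTriple.swap_AS_swap_swap_AS_swap h₁ h₃)
      (fun _ h => by
        obtain ⟨h₁, -, h₃⟩ := (AlgTriple.isGeneratorTriple_iff hk).mp h
        exact AlgTriple.swap_AS_swap_swap_AS_swap h₁ h₃)
  -- As a composite through (1), the third bijection makes the triangle commute automatically; what
  -- remains is its explicit formula.
  refine ⟨φ₁₂, φ₁₃, φ₁₂.symm.trans φ₁₃, fun t ht => rfl, fun t ht => rfl, fun t ht => ?_,
    fun c => ?_⟩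
  -- Only some representative `r` of the class is known to be a restricted triple. The triangle is
  -- applied to `r.dualAS`, and `r.dualAS.dualAS` is equivalent to `r`, hence to `t`.
  · obtain ⟨r, hr, hrt⟩ := ht
    have h₁ : AlgTriple.Equivalent r t := Quotient.exact hrt
    have h₂ := AlgTriple.triangle (hr.dualAS hk).2.1
    exact Quotient.sound (h₁.symm.dualAS.swap.AS.swap.trans
      (h₂.trans ((hr.dualAS_dualAS.symm.trans h₁).swap.AS.op)))
  · rw [Equiv.trans_apply, Equiv.symm_apply_apply]
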